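/- Let $(R,\mathfrak m)$ be a Noetherian local ring with infinite residue field, $F$ a free $R$-module of finite rank, and $M\subseteq F$ a submodule with $\ell_R(F/M)<\infty$. Powers and products are formed in the symmetric algebra $\mathrm{Sym}_R(F)$: $M^n\subseteq \mathrm{Sym}_R(F)$ is the $n$-th power of $M\subseteq F=\mathrm{Sym}^1_R(F)$, and $\mathscr R(M)=\bigoplus_{n\ge 0}M^n\subseteq \mathrm{Sym}_R(F)$ is the Rees algebra of $M$. Let $I(M)=\mathrm{Fitt}_0(F/M)$ be the zeroth Fitting ideal of $F/M$, and assume that the analytic spread $s=\dim \mathscr R(M)/\mathfrak m\mathscr R(M)$ satisfies $s\ge 1$. For an $R$-submodule $P\subseteq \mathrm{Sym}_R(F)$, a submodule $N\subseteq P$ is a reduction of $P$ if $P^{n+1}=NP^n$ for all large $n$; it is a minimal reduction if it properly contains no other reduction of $P$. Let $k\in\{1,\dots,s\}$. Among the $R$-submodules $L$ with $I(M)M\subseteq L\subseteq M$ such that, for $n\gg 0$, $\ell_R\big(LM^{n-1}/I(M)M^n\big)$ is finite and given by a polynomial in $n$ of degree at most $s-(k+1)$ (the zero polynomial if $k=s$),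 there is a largest one, denoted $M_{[k]}$, and $$M_{[k]}=\bigcup_{n_0,\ \underline x}\ M\cap\big(I(M)M^{n_0+1}:_F x_1,\dots,x_k\big),$$ where the union is over all $n_0\ge 1$ and all $s$-tuples $\underline x=(x_1,\dots,x_s)$ of elements of $M^{n_0}$ that generate a minimal reduction of $M^{n_0}$, and $(Q:_F x_1,\dots,x_k)=\{y\in F: yx_i\in Q \text{ for } 1\le i\le k\}$. -/

import Mathlib

open Polynomial

noncomputable section

namespace CoeffModules

section Fitting

/-- The zeroth Fitting ideal of a (finitely generated) module `X`: the ideal generated by the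
determinants of all square matrices whose rows are relations among the members of a finite
generating family of `X`. By Fitting's lemma the ideal generated by the determinants belonging to
one generating family does not depend on the family, so collecting all families gives the usual
ideal. -/
def fittingIdeal₀ (R X : Type*) [CommRing R] [AddCommGroup X] [Module R X] : Ideal R :=
  Ideal.span {a : R | ∃ (n : ℕ) (g : Fin n → X) (A : Matrix (Fin n) (Fin n) R),
    Submodule.span R (Set.range g) = ⊤ ∧ (∀ i, ∑ j, A i j • g j = 0) ∧ A.det = a}

end Fitting

section Reduction

variable {R A : Type*} [CommRing R] [CommRing A] [Algebra R A]

/-- `N` is a reduction of `P`, where `N` and `P` are `R`-submodules of a commutative `R`-algebra,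
whose powers and products are formed in that algebra. -/
def IsReduction (N P : Submodule R A) : Prop :=
  N ≤ P ∧ ∃ n₀ : ℕ, 0 < n₀ ∧ ∀ n, n₀ ≤ n → P ^ (n + 1) = N * P ^ n

/-- A reduction of `P` that properly contains no other reduction of `P`. -/
def IsMinimalReduction (N P : Submodule R A) : Prop :=
  Minimal (fun N' => IsReduction N' P) N

end Reduction

section Modules

variable {R F : Type*} [CommRing R] [AddCommGroup F] [Module R F]

/-- The Rees algebra of `M ⊆ F`: the image of `Sym(M) → Sym(F)`. -/
def reesAlg (M : Submodule R F) : Subalgebra R (SymmetricAlgebra R F) :=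
  (SymmetricAlgebra.lift (SymmetricAlgebra.ι R F ∘ₗ M.subtype)).range

/-- `M ^ n`, the degree `n` component of the Rees algebra, inside `Sym(F)`: the `n`-th power of the
image of `M` in degree one. -/
def modPow (M : Submodule R F) (n : ℕ) : Submodule R (SymmetricAlgebra R F) :=
  M.map (SymmetricAlgebra.ι R F) ^ n

/-- The analytic spread of `M`: the Krull dimension of the fiber cone, the quotient of the Rees
algebra by its ideal generated by the maximal ideal of `R`. -/
def analyticSpread [IsLocalRing R] (M : Submodule R F) : WithBot ℕ∞ :=
  ringKrullDim (reesAlg M ⧸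
    (IsLocalRing.maximalIdeal R).map (algebraMap R (reesAlg M)))

/-- `I(M)`, the zeroth Fitting ideal of `F / M`. -/
def fittM (M : Submodule R F) : Ideal R := fittingIdeal₀ R (F ⧸ M)

/-- The length of `L M^(n-1) / I(M) M^n` (used for `n ≥ 1` and `I(M) M ⊆ L`). -/
def gradedLength (M L : Submodule R F) (n : ℕ) : ℕ∞ :=
  Module.length R
    (↥(L.map (SymmetricAlgebra.ι R F) * modPow M (n - 1)) ⧸
      (fittM M • modPow M n).submoduleOf
        (L.map (SymmetricAlgebra.ι R F) * modPow M (n - 1)))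

/-- The submodules `L` with `I(M) M ⊆ L ⊆ M` such that, for large `n`, the length of
`L M^(n-1) / I(M) M^n` is finite and is given by a polynomial in `n` of degree at most
`s - (k + 1)`. For `k = s` the polynomial is zero. -/
def coeffSet (M : Submodule R F) (s k : ℕ) : Set (Submodule R F) :=
  {L | fittM M • M ≤ L ∧ L ≤ M ∧
    ∃ P : ℚ[X], P.degree < ((s - k : ℕ) : WithBot ℕ) ∧
      ∀ᶠ n : ℕ in Filter.atTop, ∃ l : ℕ, gradedLength M L n = l ∧ (l : ℚ) = P.eval (n : ℚ)}

/-- The coefficient module `M_[k]`, for `M` of analytic spread `s`: the supremum of `coeffSet M s k`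
(which is meant to be its largest element). -/
def coeffModule (M : Submodule R F) (s k : ℕ) : Submodule R F :=
  sSup (coeffSet M s k)

/-- The colon module `(Q :_F x_1, …, x_k)` of a submodule `Q` of `Sym(F)`: all `y` in `F` whose
products with the first `k` of the elements `x_1, …, x_s` of `Sym(F)` lie in `Q`. -/
def colonF (Q : Submodule R (SymmetricAlgebra R F)) {s : ℕ} (x : Fin s → SymmetricAlgebra R F)
    (k : ℕ) : Submodule R F where
  carrier := {y | ∀ i : Fin s, (i : ℕ) < k → SymmetricAlgebra.ι R F y * x i ∈ Q}
  add_mem' := fun ha hb i hi => by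
    rw [map_add, add_mul]
    exact Q.add_mem (ha i hi) (hb i hi)
  zero_mem' := fun i _ => by simp
  smul_mem' := fun c y hy i hi => by
    rw [map_smul, smul_mul_assoc]
    exact Q.smul_mem c (hy i hi)

end Modules

end CoeffModules

end

/-! Write `I` for `I(M)`. For `I M ≤ L ≤ M`, the lengths of `L M^n / I M^(n+1)` are the Hilbert
function of a finitely generated graded module over the Rees algebra, hence eventually polynomial.
The degree bound is therefore equivalent to saying that the sums of these lengths up to `n` are
`O(n^(s-k))` (`mem_coeffSet_iff`). This growth condition is stable under sums of submodules, so
Noetherianity of `F` yields a largest `L` (`isGreatest_coeffModule`).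

Colon elements lie in `M_[k]` (`sup_span_mem_coeffSet`). If `y` multiplies `x_1, …, x_k` into `I
M^(d+1)`, put `L = R y + I M`. These `x_i` kill `⊕ L M^n / I M^(n+1)`. Since all of `x_1, …, x_s`
together generate a reduction of `M^d`, the remaining `s - k` elements generate this module in high
degrees, up to finitely many initial degrees, and `exists_sum_relLength_le` bounds the growth.

Conversely (`exists_isMinimalReduction_of_mem_coeffSet`), let `L` satisfy the growth condition and
let `Z_n` be the set of `z` in `M^n` with `L z ⊆ I M^(n+1)`. Finitely many generators of `L` embed
`M^n / Z_n` into a finite power of `L M^n / I M^(n+1)`, so the fiber cone modulo the image of `Z`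
has dimension at most `s - k`. Homogeneous prime avoidance over the infinite residue field then
gives a system of parameters of the fiber cone, in a single degree, with `k` of its members coming
from `Z` (`exists_parameters`). Lifts of these parameters generate a reduction by Nakayama
(`exists_reduction`). It is minimal, because a smaller one would be generated modulo `𝔪` by fewer
than `s` elements and would force a smaller analytic spread (`IsReduction.isMinimalReduction`). -/

noncomputable section

namespace CoeffModules

/-! ### Calculus of lengths of subquotients -/

section RelLength

variable {R E E' : Type*} [CommRing R] [AddCommGroup E] [Module R E] [AddCommGroup E'] [Module R E']

/-- The length of `P / (P ⊓ Q)`. -/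
def relLength (P Q : Submodule R E) : ℕ∞ := Module.length R (P ⧸ Q.submoduleOf P)

lemma relLength_eq_zero_iff {P Q : Submodule R E} : relLength P Q = 0 ↔ P ≤ Q := by
  rw [relLength, Module.length_eq_zero_iff, Submodule.Quotient.subsingleton_iff,
    Submodule.submoduleOf, Submodule.comap_subtype_eq_top]

/-- The map `P → (f P + Q) / Q` is onto with kernel `P ⊓ f⁻¹ Q`. Multiplication maps between graded
pieces are measured through this. -/
lemma relLength_map_sup (f : E →ₗ[R] E') (P : Submodule R E) (Q : Submodule R E') :
    relLength (P.map f ⊔ Q) Q = relLength P (Q.comap f) := by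
  let g : P →ₗ[R] ↥(P.map f ⊔ Q) :=
    (f.comp P.subtype).codRestrict _ fun x =>
      Submodule.mem_sup_left (Submodule.mem_map_of_mem x.2)
  let h := (Q.submoduleOf (P.map f ⊔ Q)).mkQ.comp g
  have hker : LinearMap.ker h = (Q.comap f).submoduleOf P := by
    rw [LinearMap.ker_comp, Submodule.ker_mkQ]
    rfl
  have hsurj : Function.Surjective h := by
    intro y
    obtain ⟨⟨y, hy⟩, rfl⟩ := Submodule.mkQ_surjective _ y
    obtain ⟨a, ⟨p, hp, rfl⟩, q, hq, rfl⟩ := Submodule.mem_sup.1 hy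
    refine ⟨⟨p, hp⟩, ?_⟩
    simp only [h, LinearMap.comp_apply, Submodule.mkQ_apply]
    rw [Submodule.Quotient.eq]
    simp only [Submodule.submoduleOf, Submodule.mem_comap, Submodule.subtype_apply, g,
      Submodule.coe_sub]
    simpa [LinearMap.codRestrict] using hq
  rw [relLength, relLength, ← hker]
  exact ((h.quotKerEquivOfSurjective hsurj).length_eq).symm

lemma relLength_sup (P Q : Submodule R E) : relLength (P ⊔ Q) Q = relLength P Q := by
  simpa using relLength_map_sup LinearMap.id P Q

lemma relLength_mono_left {P P' : Submodule R E} (h : P ≤ P') (Q : Submodule R E) :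
    relLength P Q ≤ relLength P' Q := by
  have hle : Q.submoduleOf P ≤ (Q.submoduleOf P').comap (Submodule.inclusion h) := fun x hx => hx
  refine Module.length_le_of_injective (Submodule.mapQ _ _ (Submodule.inclusion h) hle) ?_
  rw [← LinearMap.ker_eq_bot, Submodule.ker_mapQ, ← le_bot_iff, Submodule.map_le_iff_le_comap]
  exact fun x hx => (Submodule.Quotient.mk_eq_zero _).2 hx

lemma relLength_anti_right (P : Submodule R E) {Q Q' : Submodule R E} (h : P ⊓ Q ≤ Q') :
    relLength P Q' ≤ relLength P Q := by
  have hle : Q.submoduleOf P ≤ (Q'.submoduleOf P).comap LinearMap.id := fun x hx => h ⟨x.2, hx⟩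
  refine Module.length_le_of_surjective (Submodule.mapQ _ _ LinearMap.id hle) ?_
  rw [← LinearMap.range_eq_top, Submodule.range_mapQ]
  simp

lemma relLength_bot {E : Type*} [AddCommGroup E] [Module R E] (P : Submodule R E) :
    relLength P ⊥ = Module.length R P := by
  refine LinearEquiv.length_eq (Submodule.quotEquivOfEqBot _ ?_)
  rw [Submodule.submoduleOf, Submodule.comap_bot, Submodule.ker_subtype]

lemma relLength_congr_right {P : Submodule R E} {Q Q' : Submodule R E} (h : P ⊓ Q = P ⊓ Q') :
    relLength P Q = relLength P Q' :=
  le_antisymm (relLength_anti_right _ (h.ge.trans inf_le_right))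
    (relLength_anti_right _ (h.le.trans inf_le_right))

lemma relLength_add {P X Q : Submodule R E} (hQ : Q ≤ X) (hX : X ≤ P) :
    relLength P Q = relLength X Q + relLength P X := by
  have h1 : Q.submoduleOf X ≤ (Q.submoduleOf P).comap (Submodule.inclusion hX) := fun x hx => hx
  have h2 : Q.submoduleOf P ≤ (X.submoduleOf P).comap LinearMap.id := fun x hx => hQ hx
  refine Module.length_eq_add_of_exact (Submodule.mapQ _ _ (Submodule.inclusion hX) h1)
    (Submodule.mapQ _ _ LinearMap.id h2) ?_ ?_ ?_
  · rw [← LinearMap.ker_eq_bot, Submodule.ker_mapQ, ← le_bot_iff, Submodule.map_le_iff_le_comap]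
    exact fun x hx => (Submodule.Quotient.mk_eq_zero _).2 hx
  · rw [← LinearMap.range_eq_top, Submodule.range_mapQ]
    simp
  · rw [LinearMap.exact_iff, Submodule.ker_mapQ, Submodule.range_mapQ,
      Submodule.range_inclusion]
    rfl

lemma relLength_map_le (f : E →ₗ[R] E') (P Q : Submodule R E) :
    relLength (P.map f) (Q.map f) ≤ relLength P Q := by
  rw [← relLength_sup, relLength_map_sup]
  exact relLength_anti_right _ (inf_le_right.trans (Submodule.le_comap_map f Q))

lemma relLength_map_of_injective {f : E →ₗ[R] E'} (hf : Function.Injective f)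
    (P Q : Submodule R E) : relLength (P.map f) (Q.map f) = relLength P Q := by
  rw [← relLength_sup, relLength_map_sup, Submodule.comap_map_eq_of_injective hf]

/-- Filter `P ⊇ P ⊓ A ⊇ P ⊓ A ⊓ B`; the second factor embeds in `P / (P ⊓ B)`. -/
lemma relLength_inf_le (P A B : Submodule R E) :
    relLength P (A ⊓ B) ≤ relLength P A + relLength P B := by
  have h1 : relLength P (A ⊓ B) = relLength P (P ⊓ (A ⊓ B)) :=
    relLength_congr_right (by simp)
  rw [h1, relLength_add (X := P ⊓ A) (by gcongr; exact inf_le_left) inf_le_left, add_comm]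
  exact add_le_add (relLength_anti_right _ (by simp))
    ((relLength_anti_right _ (by simp [← inf_assoc])).trans
      (relLength_mono_left (inf_le_left : P ⊓ A ≤ P) B))

lemma relLength_sup_le (A B Q : Submodule R E) :
    relLength (A ⊔ B) Q ≤ relLength A Q + relLength B Q := by
  rw [← relLength_sup (A ⊔ B) Q, relLength_add (X := A ⊔ Q) le_sup_right
    (by gcongr; exact le_sup_left),
    relLength_sup, show A ⊔ B ⊔ Q = B ⊔ (A ⊔ Q) by rw [sup_comm A B, sup_assoc], relLength_sup]
  gcongr
  exact relLength_anti_right _ (inf_le_right.trans le_sup_right)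

lemma relLength_iInf_le {ι : Type*} (t : Finset ι) (P : Submodule R E) (A : ι → Submodule R E) :
    relLength P (⨅ i ∈ t, A i) ≤ ∑ i ∈ t, relLength P (A i) := by
  classical
  induction t using Finset.induction_on with
  | empty => simp [relLength_eq_zero_iff]
  | insert a t ha ih =>
    rw [Finset.iInf_insert, Finset.sum_insert ha]
    exact (relLength_inf_le _ _ _).trans (by gcongr)

lemma relLength_ne_top_of_le {P P' Q Q' : Submodule R E} (hP : P ≤ P') (hQ : Q' ≤ Q)
    (h : relLength P' Q' ≠ ⊤) : relLength P Q ≠ ⊤ :=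
  ne_top_of_le_ne_top h
    ((relLength_anti_right _ (inf_le_right.trans hQ)).trans (relLength_mono_left hP _))

/-- The quotient is a finite module over `R / 𝔪^e`, which is Artinian because its maximal ideal is
nilpotent. -/
lemma relLength_ne_top_of_pow_smul_le [IsLocalRing R] [IsNoetherianRing R] {P Q : Submodule R E}
    (hP : P.FG) (e : ℕ) (h : IsLocalRing.maximalIdeal R ^ e • P ≤ Q) : relLength P Q ≠ ⊤ := by
  have : Module.Finite R P := Module.Finite.iff_fg.2 hP
  set X := P ⧸ Q.submoduleOf P
  set J := IsLocalRing.maximalIdeal R ^ e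
  have htors : Module.IsTorsionBySet R X J := by
    intro x ⟨r, hr⟩
    obtain ⟨x, rfl⟩ := Submodule.mkQ_surjective _ x
    change r • (Q.submoduleOf P).mkQ x = 0
    rw [← map_smul, Submodule.mkQ_apply, Submodule.Quotient.mk_eq_zero]
    exact h (Submodule.smul_mem_smul hr x.2)
  let _ : Module (R ⧸ J) X := htors.module
  have : IsScalarTower R (R ⧸ J) X := Module.IsTorsionBySet.isScalarTower htors
  have hsurj : Function.Surjective (algebraMap R (R ⧸ J)) := Ideal.Quotient.mk_surjective
  have : Module.Finite (R ⧸ J) X := Module.Finite.of_restrictScalars_finite R _ _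
  have : IsArtinianRing (R ⧸ J) := by
    rcases subsingleton_or_nontrivial (R ⧸ J) with h0 | h0
    · infer_instance
    have : IsLocalRing (R ⧸ J) := .of_surjective' _ Ideal.Quotient.mk_surjective
    rw [isArtinianRing_iff_isNilpotent_maximalIdeal]
    refine ⟨e, ?_⟩
    have hm : IsLocalRing.maximalIdeal (R ⧸ J) =
        (IsLocalRing.maximalIdeal R).map (Ideal.Quotient.mk J) :=
      (IsLocalRing.map_maximalIdeal_of_surjective _ Ideal.Quotient.mk_surjective).symm
    rw [hm, ← Ideal.map_pow, Ideal.map_quotient_self]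
    rfl
  change Module.length R X ≠ ⊤
  rw [Module.length_eq_of_surjective hsurj]
  exact Module.length_ne_top

end RelLength

/-! ### Polynomial functions and the growth of their sums -/

section NumericalPolynomials

/-- Faulhaber's formula provides the antidifference of each monomial. -/
lemma exists_antidifference (p : ℚ[X]) :
    ∃ q : ℚ[X], ∀ n : ℕ, q.eval ((n + 1 : ℕ) : ℚ) - q.eval (n : ℚ) = p.eval (n : ℚ) := by
  induction p using Polynomial.induction_on' with
  | add p₁ p₂ h₁ h₂ =>
    obtain ⟨q₁, h₁⟩ := h₁
    obtain ⟨q₂, h₂⟩ := h₂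
    refine ⟨q₁ + q₂, fun n => ?_⟩
    rw [eval_add, eval_add, eval_add, ← h₁, ← h₂]
    ring
  | monomial e a =>
    refine ⟨C a * ∑ i ∈ Finset.range (e + 1),
      C (_root_.bernoulli i * ((e + 1).choose i) / (e + 1)) * X ^ (e + 1 - i), fun n => ?_⟩
    have key : ∀ n : ℕ, (∑ i ∈ Finset.range (e + 1),
        C (_root_.bernoulli i * ((e + 1).choose i) / (e + 1)) * X ^ (e + 1 - i)).eval (n : ℚ) =
        ∑ k ∈ Finset.range n, (k : ℚ) ^ e := fun n => by
      rw [sum_range_pow, eval_finsetSum]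
      refine Finset.sum_congr rfl fun i _ => ?_
      simp only [eval_mul, eval_C, eval_pow, eval_X]
      ring
    rw [eval_mul, eval_mul, key, key, eval_C, eval_C, Finset.sum_range_succ, eval_monomial]
    ring

lemma eventually_polynomial_of_difference {h : ℕ → ℕ} {p : ℚ[X]} {n₀ : ℕ}
    (hp : ∀ n, n₀ ≤ n → (h (n + 1) : ℚ) - h n = p.eval (n : ℚ)) :
    ∃ q : ℚ[X], ∀ n, n₀ ≤ n → (h n : ℚ) = q.eval (n : ℚ) := by
  obtain ⟨q, hq⟩ := exists_antidifference p
  refine ⟨q + C ((h n₀ : ℚ) - q.eval (n₀ : ℚ)), fun n hn => ?_⟩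
  induction n, hn using Nat.le_induction with
  | base => simp
  | succ n hn ih =>
    have h1 := hp n hn
    have h2 := hq n
    simp only [eval_add, eval_C] at ih ⊢
    linarith

/-- If the degree were at least `d`, then `n^d = O(h n)`, and the terms between `n` and `2n` alone
would contribute on the order of `n^(d+1)`. -/
lemma degree_lt_of_sum_le {h : ℕ → ℕ} {p : ℚ[X]} {C d : ℕ}
    (hp : ∀ᶠ n : ℕ in Filter.atTop, (h n : ℚ) = p.eval (n : ℚ))
    (hC : ∀ n, ∑ m ∈ Finset.range (n + 1), h m ≤ C * (n + 1) ^ d) : p.degree < (d : WithBot ℕ) := by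
  by_contra! hd
  have hO : (fun x : ℚ => (X ^ d : ℚ[X]).eval x) =O[Filter.atTop] fun x => p.eval x :=
    Polynomial.isBigO_atTop_of_degree_le _ _ (by simpa using hd)
  obtain ⟨K, hK0, hK⟩ := hO.exists_pos
  have hK' := tendsto_natCast_atTop_atTop.eventually hK.bound
  obtain ⟨n₀, hn₀⟩ := Filter.eventually_atTop.1 (hp.and hK')
  have hb : ∀ n, n₀ ≤ n → ((n : ℝ)) ^ d ≤ K * h n := fun n hn => by
    obtain ⟨h1, h2⟩ := hn₀ n hn
    rw [← h1] at h2
    simp only [eval_pow, eval_X] at h2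
    have e1 : ‖((n : ℚ)) ^ d‖ = (n : ℝ) ^ d := by
      rw [norm_pow, ← Rat.norm_cast_real]
      simp
    have e2 : ‖(h n : ℚ)‖ = (h n : ℝ) := by
      rw [← Rat.norm_cast_real]
      simp
    rwa [e1, e2] at h2
  -- The estimates below give `n * n^d ≤ K * C * (2n+1)^d ≤ K * C * 3^d * n^d` for `n ≥ 1`, so any
  -- larger `n` is contradictory.
  obtain ⟨N, hN⟩ := exists_nat_gt (K * C * 3 ^ d)
  set n := max (max n₀ N) 1
  have hn1 : (1 : ℝ) ≤ n := by exact_mod_cast le_max_right _ _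
  have hnN : (N : ℝ) ≤ n := by exact_mod_cast (le_max_right _ _).trans (le_max_left _ _)
  have hnn : n₀ ≤ n := (le_max_left _ _).trans (le_max_left _ _)
  have h1 : (n : ℝ) * (n : ℝ) ^ d ≤ K * (C * (2 * n + 1) ^ d) := by
    calc (n : ℝ) * (n : ℝ) ^ d = ∑ m ∈ Finset.range n, (n : ℝ) ^ d := by simp
      _ ≤ ∑ m ∈ Finset.range n, K * (h (n + m) : ℝ) := by
          refine Finset.sum_le_sum fun m _ => le_trans ?_ (hb (n + m) (by lia))
          gcongr
          lia
      _ = K * ∑ m ∈ Finset.range n, (h (n + m) : ℝ) := by rw [Finset.mul_sum]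
      _ ≤ K * ((∑ m ∈ Finset.range (2 * n + 1), h m : ℕ) : ℝ) := by
          gcongr
          rw [show 2 * n + 1 = n + (n + 1) by ring, Finset.sum_range_add, Finset.sum_range_succ _ n]
          push_cast
          have : (0 : ℝ) ≤ ∑ m ∈ Finset.range n, (h m : ℝ) := by positivity
          have : (0 : ℝ) ≤ h (n + n) := by positivity
          linarith
      _ ≤ K * (C * (2 * n + 1) ^ d) := by
          gcongr
          exact_mod_cast hC (2 * n)
  have h2 : (2 * (n : ℝ) + 1) ^ d ≤ 3 ^ d * n ^ d := by
    rw [← mul_pow]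
    gcongr
    linarith
  have h3 : (n : ℝ) * (n : ℝ) ^ d ≤ (K * C * 3 ^ d) * n ^ d := by
    refine h1.trans ?_
    rw [mul_assoc, mul_assoc]
    gcongr
  have h4 := le_of_mul_le_mul_right h3 (by positivity)
  linarith

lemma exists_sum_le_of_degree_lt {h : ℕ → ℕ} {p : ℚ[X]} {d : ℕ}
    (hp : ∀ᶠ n : ℕ in Filter.atTop, (h n : ℚ) = p.eval (n : ℚ))
    (hd : p.degree < (d : WithBot ℕ)) :
    ∃ C : ℕ, ∀ n, ∑ m ∈ Finset.range (n + 1), h m ≤ C * (n + 1) ^ d := by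
  obtain ⟨n₀, hn₀⟩ := Filter.eventually_atTop.1 hp
  obtain ⟨K, hK⟩ := exists_nat_ge (∑ i ∈ p.support, |p.coeff i|)
  set D := ∑ m ∈ Finset.range n₀, h m
  -- Each term is `O((n+1)^(d-1))`; the factor `n + 1` is kept on the left so that `d = 0` needs no
  -- separate treatment.
  have hterm : ∀ m, n₀ ≤ m → ∀ n, m ≤ n → h m * (n + 1) ≤ K * (n + 1) ^ d := fun m hm n hmn => by
    have h1 : (h m : ℚ) * (n + 1) ≤ (∑ i ∈ p.support, |p.coeff i|) * (n + 1) ^ d := by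
      rw [hn₀ m hm, eval_eq_sum, Polynomial.sum, Finset.sum_mul, Finset.sum_mul]
      refine Finset.sum_le_sum fun i hi => ?_
      have hid : i + 1 ≤ d := by
        have := (le_degree_of_mem_supp i hi).trans_lt hd
        exact_mod_cast this
      have hm' : (m : ℚ) ≤ n + 1 := by exact_mod_cast hmn.trans (Nat.le_succ n)
      calc p.coeff i * (m : ℚ) ^ i * (n + 1) ≤ |p.coeff i| * (n + 1 : ℚ) ^ i * (n + 1) := by
            gcongr
            exact le_abs_self _
        _ = |p.coeff i| * (n + 1 : ℚ) ^ (i + 1) := by ring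
        _ ≤ _ := by
            gcongr
            linarith [(Nat.cast_nonneg n : (0 : ℚ) ≤ n)]
    have h2 : (h m : ℚ) * (n + 1) ≤ K * (n + 1) ^ d := h1.trans (by gcongr)
    exact_mod_cast h2
  refine ⟨D + K, fun n => ?_⟩
  have h1 : ∑ m ∈ Finset.range (n + 1), h m ≤
      D + ∑ m ∈ Finset.range (n + 1), (if n₀ ≤ m then h m else 0) := by
    have h0 : ∑ m ∈ Finset.range (n + 1), h m =
        ∑ m ∈ Finset.range (n + 1), (if n₀ ≤ m then 0 else h m) +
        ∑ m ∈ Finset.range (n + 1), (if n₀ ≤ m then h m else 0) := by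
      rw [← Finset.sum_add_distrib]
      exact Finset.sum_congr rfl fun m _ => by split_ifs <;> simp
    rw [h0]
    gcongr
    rw [Finset.sum_ite, Finset.sum_const_zero, zero_add]
    refine Finset.sum_le_sum_of_subset fun m hm => ?_
    simp only [Finset.mem_filter, Finset.mem_range] at hm ⊢
    lia
  have h2 : (∑ m ∈ Finset.range (n + 1), (if n₀ ≤ m then h m else 0)) ≤ K * (n + 1) ^ d := by
    refine Nat.le_of_mul_le_mul_right (c := n + 1) ?_ (Nat.succ_pos n)
    rw [Finset.sum_mul]
    refine (Finset.sum_le_card_nsmul _ _ (K * (n + 1) ^ d) fun m hm => ?_).trans ?_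
    · split_ifs with h
      · exact hterm m h n (by simpa using Finset.mem_range_succ_iff.1 hm)
      · simp
    · simp [mul_comm]
  calc _ ≤ D + K * (n + 1) ^ d := h1.trans (by gcongr)
    _ ≤ D * (n + 1) ^ d + K * (n + 1) ^ d := by
        gcongr
        exact Nat.le_mul_of_pos_right _ (by positivity)
    _ = _ := by ring

end NumericalPolynomials

/-! ### Hilbert functions of graded subquotients of an algebra -/

section Sequences

variable {R S : Type*} [CommRing R] [CommRing S] [Algebra R S]

/-- Ascending chains of families `X n ⊆ V ^ n` with `V * X n ⊆ X (n + 1)` become stationary. -/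
theorem exists_stationary [IsNoetherianRing R] {V : Submodule R S} (hV : V.FG)
    (Y : ℕ → ℕ → Submodule R S) (hmono : Monotone Y) (hle : ∀ j n, Y j n ≤ V ^ n)
    (hst : ∀ j n, V * Y j n ≤ Y j (n + 1)) : ∃ j₀, ∀ j, j₀ ≤ j → Y j = Y j₀ := by
  classical
  obtain ⟨s, rfl⟩ := hV
  set V := Submodule.span R (s : Set S)
  -- `A` is the Rees algebra `⊕ V^n T^n`, Noetherian since finitely generated over `R`. A family
  -- stable under `V` is a homogeneous ideal of it, so the claim is the ascending chain condition.
  let A : Subalgebra R S[X] := Algebra.adjoin R (s.image (monomial 1 : S → S[X]))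
  have hA : IsNoetherianRing A := isNoetherianRing_of_fg ⟨_, rfl⟩
  have hcoeff : ∀ f ∈ A, ∀ n, f.coeff n ∈ V ^ n := by
    intro f hf
    induction hf using Algebra.adjoin_induction with
    | mem f hf =>
      intro n
      obtain ⟨v, hv, rfl⟩ := Finset.mem_image.1 (Finset.mem_coe.1 hf)
      rw [coeff_monomial]
      split_ifs with h
      · subst h
        simpa using Submodule.subset_span hv
      · exact zero_mem _
    | algebraMap r =>
      intro n
      rw [Polynomial.algebraMap_apply, coeff_C]
      split_ifs with h
      · subst h
        rw [pow_zero]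
        exact Submodule.algebraMap_mem r
      · exact zero_mem _
    | add f g _ _ hf hg => exact fun n => by rw [coeff_add]; exact add_mem (hf n) (hg n)
    | mul f g _ _ hf hg =>
      intro n
      rw [coeff_mul]
      refine sum_mem fun ij hij => ?_
      rw [← Finset.HasAntidiagonal.mem_antidiagonal.1 hij, pow_add]
      exact Submodule.mul_mem_mul (hf _) (hg _)
  have hmon : ∀ n, ∀ x ∈ V ^ n, monomial n x ∈ A := by
    have h1 : ∀ x ∈ V, monomial 1 x ∈ A := fun x hx => by
      induction hx using Submodule.span_induction with
      | mem x hx => exact Algebra.subset_adjoin (by simpa using ⟨x, hx, rfl⟩)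
      | zero => simp
      | add x y _ _ hx hy => rw [map_add]; exact add_mem hx hy
      | smul r x _ hx => rw [← Polynomial.smul_monomial]; exact A.smul_mem hx r
    intro n
    induction n with
    | zero =>
      intro x hx
      rw [pow_zero, Submodule.mem_one] at hx
      obtain ⟨r, rfl⟩ := hx
      exact A.algebraMap_mem r
    | succ n ih =>
      intro x hx
      rw [pow_succ] at hx
      induction hx using Submodule.mul_induction_on' with
      | mem_mul_mem a ha b hb =>
        rw [← monomial_mul_monomial]
        exact mul_mem (ih a ha) (h1 b hb)
      | add x _ y _ hx hy => rw [map_add]; exact add_mem hx hy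
  have hst' : ∀ j i n, V ^ i * Y j n ≤ Y j (i + n) := by
    intro j i
    induction i with
    | zero => intro n; simp
    | succ i ih =>
      intro n
      rw [pow_succ, mul_assoc, show i + 1 + n = i + (n + 1) by ring]
      exact (mul_le_mul_right (hst j n) _).trans (ih (n + 1))
  let Z : ℕ →o Ideal A :=
    { toFun := fun j =>
        { carrier := {f | ∀ n, (f : S[X]).coeff n ∈ Y j n}
          add_mem' := fun ha hb n => by
            rw [Subalgebra.coe_add, coeff_add]
            exact add_mem (ha n) (hb n)
          zero_mem' := fun n => by simp
          smul_mem' := fun c f hf n => by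
            rw [smul_eq_mul, Subalgebra.coe_mul, coeff_mul]
            refine sum_mem fun ij hij => ?_
            rw [← Finset.HasAntidiagonal.mem_antidiagonal.1 hij]
            exact hst' j _ _ (Submodule.mul_mem_mul (hcoeff _ c.2 _) (hf _)) }
      monotone' := fun i j hij f hf n => hmono hij n (hf n) }
  have hZ : ∀ j n x, (hx : x ∈ V ^ n) → ((⟨monomial n x, hmon n x hx⟩ : A) ∈ Z j ↔ x ∈ Y j n) := by
    intro j n x hx
    refine ⟨fun h => by simpa using h n, fun h m => ?_⟩
    change (monomial n x).coeff m ∈ _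
    rw [coeff_monomial]
    split_ifs with hnm
    · exact hnm ▸ h
    · exact zero_mem _
  obtain ⟨j₀, hj₀⟩ := monotone_stabilizes_iff_noetherian.2 hA Z
  refine ⟨j₀, fun j hj => ?_⟩
  funext n
  refine le_antisymm (fun x hx => ?_) (hmono hj n)
  have hm := (hZ j n x (hle _ _ hx)).2 hx
  rw [← hj₀ j hj] at hm
  exact (hZ j₀ n x (hle _ _ hx)).1 hm

/-- The Hilbert function of a finitely generated graded module `⊕ P n / Q n` is eventually
polynomial. -/
theorem exists_hilbert_polynomial_aux [IsNoetherianRing R] {V : Submodule R S} (hV : V.FG)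
    (l : List S) : ∀ (P Q : ℕ → Submodule R S), (∀ n, Q n ≤ P n) → (∀ n, P n ≤ V ^ n) →
      (∀ n, V * P n ≤ P (n + 1)) → (∀ n, V * Q n ≤ Q (n + 1)) →
      (∀ n, relLength (P n) (Q n) ≠ ⊤) → (∀ a ∈ l, a ∈ V) →
      (∀ v ∈ V, ∃ u ∈ Submodule.span R {a | a ∈ l}, ∀ n, ∀ p ∈ P n, (v - u) * p ∈ Q (n + 1)) →
      ∃ (p : ℚ[X]) (n₀ : ℕ), ∀ n, n₀ ≤ n →
        ((relLength (P n) (Q n)).toNat : ℚ) = p.eval (n : ℚ) := by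
  induction l with
  | nil =>
    intro P Q hQP hPV hP hQ _ _ hact
    have hVP : ∀ n, V * P n ≤ Q (n + 1) := fun n => Submodule.mul_le.2 fun v hv p hp => by
      obtain ⟨u, hu, h⟩ := hact v hv
      have hu0 : u = 0 := by simpa using hu
      simpa [hu0] using h n p hp
    -- With no generators left, `V` carries `P` into `Q`, so replacing `Q` by `P` in degrees below
    -- `j` keeps the family stable. Stationarity in `j` means `P n = Q n` for large `n`.
    obtain ⟨j₀, hj₀⟩ := exists_stationary hV (fun j n => if n < j then P n else Q n)
      (fun i j hij n => by
        dsimp only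
        split_ifs with h1 h2
        · exact le_rfl
        · omega
        · exact hQP n
        · exact le_rfl)
      (fun j n => by
        split_ifs
        exacts [hPV n, (hQP n).trans (hPV n)])
      (fun j n => by
        split_ifs with h1 h2
        · exact hP n
        · exact hVP n
        · omega
        · exact hQ n)
    refine ⟨0, j₀, fun n hn => ?_⟩
    have := congrFun (hj₀ (n + 1) (by omega)) n
    simp only [Nat.lt_succ_self, if_true, if_neg (not_lt.2 hn)] at this
    simp [relLength_eq_zero_iff.2 this.le]
  | cons a l ih =>
    intro P Q hQP hPV hP hQ hfin hl hact
    have haV : a ∈ V := hl a (by simp)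
    let f := LinearMap.mulLeft R a
    have haP : ∀ n, (P n).map f ≤ P (n + 1) := fun n =>
      Submodule.map_le_iff_le_comap.2 fun p hp => hP n (Submodule.mul_mem_mul haV hp)
    -- `K / Q` is the kernel and `P / D` the cokernel of multiplication by `a` on `P / Q`. On both
    -- of them `a` acts as zero, so the induction hypothesis applies, and their lengths determine
    -- the first difference of the Hilbert function.
    let K : ℕ → Submodule R S := fun n => P n ⊓ (Q (n + 1)).comap f
    let D : ℕ → Submodule R S := fun n => n.casesOn (Q 0) fun m => (P m).map f ⊔ Q (m + 1)
    have hQK : ∀ n, Q n ≤ K n := fun n =>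
      le_inf (hQP n) fun q hq => hQ n (Submodule.mul_mem_mul haV hq)
    have hDP : ∀ n, D n ≤ P n := by
      rintro (_ | n)
      exacts [hQP 0, sup_le (haP n) (hQP _)]
    have hQD : ∀ n, Q n ≤ D n := by
      rintro (_ | n)
      exacts [le_rfl, le_sup_right]
    have hKst : ∀ n, V * K n ≤ K (n + 1) := fun n => Submodule.mul_le.2 fun v hv p hp =>
      ⟨hP n (Submodule.mul_mem_mul hv hp.1), by
        change a * (v * p) ∈ Q (n + 1 + 1)
        rw [mul_left_comm]
        exact hQ _ (Submodule.mul_mem_mul hv hp.2)⟩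
    have hDst : ∀ n, V * D n ≤ D (n + 1) := by
      rintro (_ | n)
      · exact (hQ 0).trans le_sup_right
      · refine Submodule.mul_le.2 fun v hv p hp => ?_
        obtain ⟨_, ⟨p', hp', rfl⟩, q, hq, rfl⟩ := Submodule.mem_sup.1 hp
        rw [mul_add]
        refine add_mem (Submodule.mem_sup_left ⟨v * p', hP _ (Submodule.mul_mem_mul hv hp'), ?_⟩)
          (Submodule.mem_sup_right (hQ _ (Submodule.mul_mem_mul hv hq)))
        exact mul_left_comm a v p'
    have hact' : ∀ v ∈ V, ∃ u ∈ Submodule.span R {b | b ∈ l}, ∃ c : R, ∀ n, ∀ p ∈ P n,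
        (v - u) * p - c • (a * p) ∈ Q (n + 1) := by
      intro v hv
      obtain ⟨u, hu, h⟩ := hact v hv
      have : {b | b ∈ a :: l} = insert a {b | b ∈ l} := by ext; simp
      rw [this, Submodule.mem_span_insert] at hu
      obtain ⟨c, u', hu', rfl⟩ := hu
      refine ⟨u', hu', c, fun n p hp => ?_⟩
      convert h n p hp using 1
      rw [← smul_mul_assoc]
      ring
    obtain ⟨p₁, n₁, h₁⟩ := ih K Q hQK (fun n => inf_le_left.trans (hPV n)) hKst hQ
      (fun n => relLength_ne_top_of_le inf_le_left le_rfl (hfin n))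
      (fun b hb => hl b (by simp [hb])) (fun v hv => by
        obtain ⟨u, hu, c, h⟩ := hact' v hv
        refine ⟨u, hu, fun n p hp => ?_⟩
        have := add_mem (h n p hp.1) ((Q (n + 1)).smul_mem c hp.2)
        rwa [LinearMap.mulLeft_apply, sub_add_cancel] at this)
    obtain ⟨p₂, n₂, h₂⟩ := ih P D hDP hPV hP hDst
      (fun n => relLength_ne_top_of_le le_rfl (hQD n) (hfin n))
      (fun b hb => hl b (by simp [hb])) (fun v hv => by
        obtain ⟨u, hu, c, h⟩ := hact' v hv
        refine ⟨u, hu, fun n p hp => ?_⟩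
        have := add_mem (hQD _ (h n p hp)) (Submodule.smul_mem _ c
          (Submodule.mem_sup_left (Submodule.mem_map_of_mem hp) : f p ∈ D (n + 1)))
        rwa [LinearMap.mulLeft_apply, sub_add_cancel] at this)
    have hstep : ∀ n, ((relLength (P (n + 1)) (Q (n + 1))).toNat : ℚ) -
        (relLength (P n) (Q n)).toNat = (relLength (P (n + 1)) (D (n + 1))).toNat -
          (relLength (K n) (Q n)).toNat := by
      intro n
      have e1 := relLength_add (hQD (n + 1)) (hDP (n + 1))
      have e2 := relLength_add (hQK n) (inf_le_left : K n ≤ P n)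
      have e3 : relLength (D (n + 1)) (Q (n + 1)) = relLength (P n) (K n) := by
        refine (relLength_map_sup f (P n) (Q (n + 1))).trans (relLength_congr_right ?_)
        simp [K]
      have f1 : relLength (P n) (K n) ≠ ⊤ := relLength_ne_top_of_le le_rfl (hQK n) (hfin n)
      have f2 : relLength (K n) (Q n) ≠ ⊤ := relLength_ne_top_of_le inf_le_left le_rfl (hfin n)
      have f3 : relLength (P (n + 1)) (D (n + 1)) ≠ ⊤ :=
        relLength_ne_top_of_le le_rfl (hQD _) (hfin _)
      rw [e1, e2, e3, ENat.toNat_add f1 f3, ENat.toNat_add f2 f1]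
      push_cast
      ring
    obtain ⟨q, hq⟩ := eventually_polynomial_of_difference
      (h := fun n => (relLength (P n) (Q n)).toNat) (p := p₂.comp (X + 1) - p₁)
      (n₀ := max n₁ n₂) (fun n hn => by
        have h₂' := h₂ (n + 1) (by omega)
        rw [hstep, h₁ n (by omega), h₂']
        simp)
    exact ⟨q, _, hq⟩

theorem exists_hilbert_polynomial [IsNoetherianRing R] {V : Submodule R S} (hV : V.FG)
    {P Q : ℕ → Submodule R S} (hQP : ∀ n, Q n ≤ P n) (hPV : ∀ n, P n ≤ V ^ n)
    (hP : ∀ n, V * P n ≤ P (n + 1)) (hQ : ∀ n, V * Q n ≤ Q (n + 1))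
    (hfin : ∀ n, relLength (P n) (Q n) ≠ ⊤) :
    ∃ (p : ℚ[X]) (n₀ : ℕ), ∀ n, n₀ ≤ n →
      ((relLength (P n) (Q n)).toNat : ℚ) = p.eval (n : ℚ) := by
  obtain ⟨s, hs⟩ := hV
  refine exists_hilbert_polynomial_aux ⟨s, hs⟩ s.toList P Q hQP hPV hP hQ hfin
    (fun a ha => hs ▸ Submodule.subset_span (by simpa using ha)) fun v hv => ⟨v, ?_, ?_⟩
  · simpa [hs] using hv
  · simp

/-- If multiplication by `x i`, `i ∈ J`, of degree `d ≥ 1` eventually generates `⊕ P n / Q n`, then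
the length of `⊕_{m ≤ n} P m / Q m` is `O(n ^ |J|)`. -/
theorem exists_sum_relLength_le {ι : Type*} (J : Finset ι) (x : ι → S) {d : ℕ} (hd : 1 ≤ d)
    {P : ℕ → Submodule R S} : ∀ {Q : ℕ → Submodule R S}, (∀ n, Q n ≤ P n) →
      (∀ i ∈ J, ∀ n, (P n).map (LinearMap.mulLeft R (x i)) ≤ P (n + d)) →
      (∀ i ∈ J, ∀ n, (Q n).map (LinearMap.mulLeft R (x i)) ≤ Q (n + d)) →
      (∀ n, relLength (P n) (Q n) ≠ ⊤) →
      (∃ c, ∀ n, c ≤ n →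
        P (n + d) ≤ Q (n + d) ⊔ ⨆ i ∈ J, (P n).map (LinearMap.mulLeft R (x i))) →
      ∃ C : ℕ, ∀ n, ∑ m ∈ Finset.range (n + 1), (relLength (P m) (Q m)).toNat ≤
        C * (n + 1) ^ J.card := by
  classical
  induction J using Finset.induction_on with
  | empty =>
    rintro Q hQP - - hfin ⟨c, hc⟩
    refine exists_sum_le_of_degree_lt (p := 0) ?_ (by simp)
    refine Filter.eventually_atTop.2 ⟨c + d, fun n hn => ?_⟩
    obtain ⟨m, rfl⟩ := Nat.exists_eq_add_of_le' hn
    have h := hc (m + c) (by omega)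
    rw [show m + c + d = m + (c + d) by ring] at h
    simp only [Finset.notMem_empty, iSup_false, iSup_bot, sup_bot_eq] at h
    simp [relLength_eq_zero_iff.2 h]
  | insert a J ha ih =>
    rintro Q hQP hP hQ hfin ⟨c, hc⟩
    let f := LinearMap.mulLeft R (x a)
    -- `P / D` is the quotient of `P / Q` by the image of `x a`; it is eventually generated by the
    -- remaining elements.
    let D : ℕ → Submodule R S := fun n => if d ≤ n then (P (n - d)).map f ⊔ Q n else Q n
    have hDd : ∀ n, D (n + d) = (P n).map f ⊔ Q (n + d) := fun n => by simp [D]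
    have hQD : ∀ n, Q n ≤ D n := fun n => by
      dsimp only [D]
      split_ifs
      exacts [le_sup_right, le_rfl]
    have hDP : ∀ n, D n ≤ P n := fun n => by
      dsimp only [D]
      split_ifs with h
      · refine sup_le ?_ (hQP n)
        simpa [Nat.sub_add_cancel h] using hP a (by simp) (n - d)
      · exact hQP n
    obtain ⟨C, hC⟩ := ih hDP (fun i hi => hP i (by simp [hi])) (fun i hi n => by
        rw [hDd]
        dsimp only [D]
        split_ifs with h
        · rw [Submodule.map_sup]
          refine sup_le_sup ?_ (hQ i (by simp [hi]) n)
          have h1 := hP i (by simp [hi]) (n - d)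
          rw [Nat.sub_add_cancel h] at h1
          refine le_trans ?_ (Submodule.map_mono h1)
          rw [← Submodule.map_comp, ← Submodule.map_comp]
          refine le_of_eq (congrArg (fun g => Submodule.map g _) ?_)
          ext y
          exact mul_left_comm _ _ _
        · exact (hQ i (by simp [hi]) n).trans le_sup_right)
      (fun n => relLength_ne_top_of_le le_rfl (hQD n) (hfin n))
      ⟨c, fun n hn => by
        refine (hc n hn).trans ?_
        rw [Finset.iSup_insert, hDd, ← sup_assoc, sup_comm (Q (n + d))]⟩
    have hlow : ∀ n, n < d →
        (relLength (P n) (Q n)).toNat = (relLength (P n) (D n)).toNat := fun n hn => by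
      simp [D, not_le.2 hn]
    have hhigh : ∀ n, (relLength (P (d + n)) (Q (d + n))).toNat ≤
        (relLength (P (d + n)) (D (d + n))).toNat + (relLength (P n) (Q n)).toNat := fun n => by
      have e1 := relLength_add (hQD (d + n)) (hDP (d + n))
      have e2 : relLength (D (d + n)) (Q (d + n)) ≤ relLength (P n) (Q n) := by
        rw [add_comm d n, hDd, relLength_map_sup]
        exact relLength_anti_right _
          (inf_le_right.trans (Submodule.map_le_iff_le_comap.1 (hQ a (by simp) n)))
      have f1 := relLength_ne_top_of_le (hDP (d + n)) le_rfl (hfin (d + n))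
      have f2 := relLength_ne_top_of_le le_rfl (hQD (d + n)) (hfin (d + n))
      rw [e1, ENat.toNat_add f1 f2, add_comm]
      refine Nat.add_le_add_left ?_ _
      exact ENat.toNat_le_toNat e2 (hfin n)
    refine ⟨C, fun n => ?_⟩
    rw [Finset.card_insert_of_notMem ha]
    induction n using Nat.strong_induction_on with
    | _ n ihn =>
    -- The sum up to `n` exceeds that for `P / D` by at most the sum for `P / Q` up to `n - d`. As
    -- `d ≥ 1`, induction bounds the latter by `C * n^(|J|+1)`.
    have hstep : ∑ m ∈ Finset.range (n + 1), (relLength (P m) (Q m)).toNat ≤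
        ∑ m ∈ Finset.range (n + 1), (relLength (P m) (D m)).toNat + C * n * (n + 1) ^ J.card := by
      rcases lt_or_ge n d with hnd | hnd
      · rw [Finset.sum_congr rfl fun m hm => hlow m (by have := Finset.mem_range.1 hm; omega)]
        exact Nat.le_add_right _ _
      · obtain ⟨e, rfl⟩ := Nat.exists_eq_add_of_le hnd
        rw [add_assoc d e 1, Finset.sum_range_add _ d (e + 1), Finset.sum_range_add _ d (e + 1),
          Finset.sum_congr rfl fun m hm => hlow m (Finset.mem_range.1 hm), add_assoc]
        gcongr
        refine (Finset.sum_le_sum fun m _ => hhigh m).trans ?_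
        rw [Finset.sum_add_distrib]
        gcongr
        refine (ihn e (by omega)).trans ?_
        calc C * (e + 1) ^ (J.card + 1) = C * (e + 1) * (e + 1) ^ J.card := by ring
          _ ≤ _ := Nat.mul_le_mul (Nat.mul_le_mul le_rfl (by omega))
              (Nat.pow_le_pow_left (by omega) _)
    calc _ ≤ C * (n + 1) ^ J.card + C * n * (n + 1) ^ J.card := hstep.trans (by gcongr; exact hC n)
      _ = _ := by ring

end Sequences

/-! ### Krull dimension bounded by growth -/

section Dimension

/-- Incomparability: strict inclusions of primes stay strict after contraction along an integral
map. -/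
lemma ringKrullDim_le_of_isIntegral {A B : Type*} [CommRing A] [CommRing B] [Algebra A B]
    [Algebra.IsIntegral A B] : ringKrullDim B ≤ ringKrullDim A := by
  refine Order.krullDim_le_of_strictMono (PrimeSpectrum.comap (algebraMap A B)) fun p q hpq => ?_
  exact Ideal.IsIntegral.comap_lt_comap hpq

variable {k D : Type*} [Field k] [CommRing D] [Algebra k D]

lemma pow_le_pow_one_sup (V : Submodule k D) {m n : ℕ} (h : m ≤ n) :
    (1 ⊔ V) ^ m ≤ (1 ⊔ V) ^ n := by
  obtain ⟨e, rfl⟩ := Nat.exists_eq_add_of_le h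
  rw [pow_add]
  calc (1 ⊔ V) ^ m = (1 ⊔ V) ^ m * 1 := (mul_one _).symm
    _ ≤ _ := mul_le_mul_right (one_le_pow_of_one_le' le_sup_left e) _

lemma exists_mem_one_sup_pow {V : Submodule k D} (htop : Algebra.adjoin k (V : Set D) = ⊤)
    (x : D) : ∃ n, x ∈ (1 ⊔ V) ^ n := by
  have hx : x ∈ Algebra.adjoin k (V : Set D) := htop ▸ Algebra.mem_top
  induction hx using Algebra.adjoin_induction with
  | mem x hx => exact ⟨1, by rw [pow_one]; exact Submodule.mem_sup_right hx⟩
  | algebraMap r => exact ⟨0, by rw [pow_zero]; exact Submodule.algebraMap_mem r⟩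
  | add x y _ _ hx hy =>
    obtain ⟨m, hm⟩ := hx
    obtain ⟨n, hn⟩ := hy
    exact ⟨max m n, add_mem (pow_le_pow_one_sup V (le_max_left _ _) hm)
      (pow_le_pow_one_sup V (le_max_right _ _) hn)⟩
  | mul x y _ _ hx hy =>
    obtain ⟨m, hm⟩ := hx
    obtain ⟨n, hn⟩ := hy
    exact ⟨m + n, by rw [pow_add]; exact Submodule.mul_mem_mul hm hn⟩

lemma one_sup_pow_le (V : Submodule k D) (n : ℕ) :
    (1 ⊔ V) ^ n ≤ ⨆ i ∈ Finset.range (n + 1), V ^ i := by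
  have hle : ∀ {i m : ℕ}, i ≤ m → V ^ i ≤ ⨆ i ∈ Finset.range (m + 1), V ^ i := fun {i m} h =>
    le_iSup₂_of_le i (Finset.mem_range.2 (by omega)) le_rfl
  induction n with
  | zero => simp
  | succ n ih =>
    rw [pow_succ']
    refine (mul_le_mul_right ih _).trans ?_
    simp only [Submodule.sup_mul, Submodule.mul_iSup, one_mul]
    refine iSup₂_le fun i hi => sup_le (hle ?_) ?_
    · have := Finset.mem_range.1 hi; omega
    · rw [← pow_succ']
      exact hle (by have := Finset.mem_range.1 hi; omega)

lemma finrank_biSup_le {E ι : Type*} [AddCommGroup E] [Module k E] (t : Finset ι)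
    (W : ι → Submodule k E) (hW : ∀ i, (W i).FG) :
    Module.finrank k ↥(⨆ i ∈ t, W i) ≤ ∑ i ∈ t, Module.finrank k (W i) := by
  classical
  induction t using Finset.induction_on with
  | empty =>
    have : ⨆ i ∈ (∅ : Finset ι), W i = ⊥ := by simp
    rw [this, finrank_bot]
    exact Nat.zero_le _
  | insert a t ha ih =>
    rw [Finset.iSup_insert, Finset.sum_insert ha]
    have : Module.Finite k (W a) := Module.Finite.iff_fg.2 (hW a)
    have : Module.Finite k ↥(⨆ i ∈ t, W i) :=
      Module.Finite.iff_fg.2 (Submodule.fg_biSup t W fun i _ => hW i)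
    exact (Submodule.finrank_add_le_finrank_add_finrank _ _).trans (by gcongr)

lemma finiteType_of_adjoin_eq_top {V : Submodule k D} (hV : V.FG)
    (htop : Algebra.adjoin k (V : Set D) = ⊤) : Algebra.FiniteType k D := by
  obtain ⟨s, rfl⟩ := hV
  exact ⟨s, by rwa [Algebra.adjoin_span] at htop⟩

/-- The dimension of an algebra generated by `V` is bounded by the growth of the powers of `V`. -/
theorem ringKrullDim_le_of_sum_finrank_le {V : Submodule k D} (hV : V.FG)
    (htop : Algebra.adjoin k (V : Set D) = ⊤) {C d : ℕ}
    (hC : ∀ n, ∑ m ∈ Finset.range (n + 1), Module.finrank k ↥(V ^ m) ≤ C * (n + 1) ^ d) :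
    ringKrullDim D ≤ d := by
  rcases subsingleton_or_nontrivial D with hD | hD
  · simp [ringKrullDim_eq_bot_of_subsingleton]
  have := finiteType_of_adjoin_eq_top hV htop
  -- Noether normalization: the dimension is at most the number `e` of variables, and `e` is then
  -- bounded by counting monomials.
  obtain ⟨e, g, hinj, hfin⟩ := exists_finite_inj_algHom_of_fg k D
  have hdim : ringKrullDim D ≤ e := by
    let _ := g.toRingHom.toAlgebra
    have : Module.Finite (MvPolynomial (Fin e) k) D := hfin
    refine (ringKrullDim_le_of_isIntegral (A := MvPolynomial (Fin e) k)).trans ?_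
    rw [MvPolynomial.ringKrullDim_of_isNoetherianRing]
    simp
  refine hdim.trans ?_
  suffices e ≤ d by exact_mod_cast this
  by_contra! hed
  choose n hn using fun i => exists_mem_one_sup_pow htop (g (MvPolynomial.X i))
  set c := ∑ i, n i
  have hc : ∀ i, g (MvPolynomial.X i) ∈ (1 ⊔ V) ^ c := fun i =>
    pow_le_pow_one_sup V (Finset.single_le_sum (fun _ _ => Nat.zero_le _) (Finset.mem_univ i))
      (hn i)
  -- The `N^e` monomials with all exponents below `N` stay independent in `D`, and they lie in `(1 +
  -- V)^(c e N)` because each variable lies in `(1 + V)^c`.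
  have hcount : ∀ N : ℕ, N ^ e ≤ C * (c * (e * N) + 1) ^ d := by
    intro N
    let mon : (Fin e → Fin N) → (Fin e →₀ ℕ) := fun f =>
      Finsupp.equivFunOnFinite.symm fun i => (f i : ℕ)
    have hmon : Function.Injective mon := fun f f' h => by
      funext i
      exact Fin.ext (congrFun (Finsupp.equivFunOnFinite.symm.injective h) i)
    have hli : LinearIndependent k fun f : Fin e → Fin N =>
        g.toLinearMap (MvPolynomial.basisMonomials (Fin e) k (mon f)) :=
      ((MvPolynomial.basisMonomials (Fin e) k).linearIndependent.comp mon hmon).map'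
        g.toLinearMap (LinearMap.ker_eq_bot.2 hinj)
    have hmem : ∀ f : Fin e → Fin N,
        g.toLinearMap (MvPolynomial.basisMonomials (Fin e) k (mon f)) ∈
          (1 ⊔ V) ^ (c * (e * N)) := by
      intro f
      rw [MvPolynomial.coe_basisMonomials]
      beta_reduce
      rw [MvPolynomial.monomial_eq, map_one, one_mul,
        Finsupp.prod_fintype _ _ (fun i => pow_zero _), AlgHom.toLinearMap_apply, map_prod]
      have h1 : ∀ t : Finset (Fin e), ∏ i ∈ t, g (MvPolynomial.X i ^ mon f i) ∈
          (1 ⊔ V) ^ (c * (t.card * N)) := by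
        intro t
        induction t using Finset.induction_on with
        | empty => simp
        | insert a t ha ih =>
          rw [Finset.prod_insert ha, Finset.card_insert_of_notMem ha, add_mul, mul_add, add_comm,
            one_mul, pow_add, map_pow]
          refine Submodule.mul_mem_mul ?_ ih
          have h2 := Submodule.pow_mem_pow _ (hc a) (mon f a)
          rw [← pow_mul] at h2
          exact pow_le_pow_one_sup V (Nat.mul_le_mul le_rfl (f a).2.le) h2
      simpa using h1 Finset.univ
    have hfg : ((1 ⊔ V) ^ (c * (e * N))).FG :=
      Submodule.FG.pow (Submodule.FG.sup
        ⟨{1}, by rw [Finset.coe_singleton, Submodule.one_eq_span]⟩ hV) _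
    have : Module.Finite k ↥((1 ⊔ V) ^ (c * (e * N))) := Module.Finite.iff_fg.2 hfg
    have hli' : LinearIndependent k fun f : Fin e → Fin N =>
        (⟨_, hmem f⟩ : ↥((1 ⊔ V) ^ (c * (e * N)))) :=
      LinearIndependent.of_comp (Submodule.subtype _) hli
    have h2 := hli'.fintype_card_le_finrank
    simp only [Fintype.card_pi, Fintype.card_fin, Finset.prod_const, Finset.card_univ] at h2
    have : Module.Finite k ↥(⨆ i ∈ Finset.range (c * (e * N) + 1), V ^ i) :=
      Module.Finite.iff_fg.2 (Submodule.fg_biSup _ _ fun i _ => hV.pow i)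
    exact h2.trans ((Submodule.finrank_mono (one_sup_pow_le V _)).trans
      ((finrank_biSup_le _ _ fun i => hV.pow i).trans (hC _)))
  set N := C * (c * e + 1) ^ d + 1
  have h1 : N * N ^ d ≤ C * (c * e + 1) ^ d * N ^ d := by
    calc N * N ^ d = N ^ (d + 1) := by ring
      _ ≤ N ^ e := Nat.pow_le_pow_right (Nat.succ_pos _) hed
      _ ≤ C * (c * (e * N) + 1) ^ d := hcount N
      _ ≤ C * ((c * e + 1) * N) ^ d := by
          gcongr
          rw [add_mul, mul_assoc, one_mul]
          gcongr
          exact Nat.succ_pos _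
      _ = _ := by rw [mul_pow]; ring
  have h2 := Nat.le_of_mul_le_mul_right h1 (by positivity)
  omega

end Dimension

/-! ### Homogeneous parameters by prime avoidance -/

section PrimeAvoidance

lemma ringKrullDim_quotient_le_iff {D : Type*} [CommRing D] {I : Ideal D} {d : ℕ} :
    ringKrullDim (D ⧸ I) ≤ d ↔
      ∀ l : LTSeries (PrimeSpectrum D), I ≤ l.head.asIdeal → l.length ≤ d := by
  rw [ringKrullDim_quotient]
  refine ⟨fun h l hl => ?_, fun h => iSup_le fun l => ?_⟩
  · let l' : LTSeries (PrimeSpectrum.zeroLocus (R := D) I) :=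
      { length := l.length
        toFun := fun i => ⟨l i, hl.trans (l.monotone (Fin.zero_le i))⟩
        step := fun i => l.step i }
    exact_mod_cast (Order.LTSeries.length_le_krullDim l').trans h
  · exact_mod_cast h (l.map Subtype.val fun _ _ => id) l.head.2

variable {D : Type*} [CommRing D]

lemma ringKrullDim_quotient_mono {I J : Ideal D} (h : I ≤ J) :
    ringKrullDim (D ⧸ J) ≤ ringKrullDim (D ⧸ I) :=
  ringKrullDim_le_of_surjective _ (Ideal.Quotient.factor_surjective h)

/-- A chain of primes over `I + (x)` starts above a minimal prime `P` of `I`. If `x ∉ P`, then `P`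
can be prepended to it; if `x ∈ P`, the chain is bounded by `dim D / P`. -/
lemma ringKrullDim_quotient_sup_span_le {I : Ideal D} {x : D} {d : ℕ}
    (hI : ringKrullDim (D ⧸ I) ≤ (d + 1 : ℕ))
    (hx : ∀ P ∈ I.minimalPrimes, x ∈ P → ringKrullDim (D ⧸ P) ≤ d) :
    ringKrullDim (D ⧸ (I ⊔ Ideal.span {x})) ≤ d := by
  rw [ringKrullDim_quotient_le_iff] at hI ⊢
  intro l hl
  have hxl : x ∈ l.head.asIdeal := hl (Ideal.mem_sup_right (Ideal.mem_span_singleton_self x))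
  obtain ⟨P, hP, hPl⟩ := Ideal.exists_minimalPrimes_le (le_sup_left.trans hl)
  by_cases hxP : x ∈ P
  · exact ringKrullDim_quotient_le_iff.1 (hx P hP hxP) l hPl
  · let p : PrimeSpectrum D := ⟨P, hP.1.1⟩
    have hp : p < l.head := lt_of_le_of_ne hPl fun h => hxP (by rw [← h] at hxl; exact hxl)
    have := hI (l.cons p hp) (by simpa using hP.1.2)
    simpa using this

variable {k : Type*} [Field k] [Algebra k D]

/-- When all generators lie in `P`, the quotient is an image of the field `k`. -/
lemma ringKrullDim_quotient_le_zero_of_le {V : Submodule k D}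
    (htop : Algebra.adjoin k (V : Set D) = ⊤) {P : Ideal D} (h : ∀ v ∈ V, v ∈ P) :
    ringKrullDim (D ⧸ P) ≤ 0 := by
  rw [← ringKrullDim_eq_zero_of_field k]
  refine ringKrullDim_le_of_surjective (algebraMap k (D ⧸ P)) fun y => ?_
  obtain ⟨x, rfl⟩ := Ideal.Quotient.mk_surjective y
  have hx : x ∈ Algebra.adjoin k (V : Set D) := htop ▸ Algebra.mem_top
  induction hx using Algebra.adjoin_induction with
  | mem x hx => exact ⟨0, by rw [map_zero, Ideal.Quotient.eq_zero_iff_mem.2 (h x hx)]⟩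
  | algebraMap r => exact ⟨r, rfl⟩
  | add x y _ _ hx hy =>
    obtain ⟨a, ha⟩ := hx
    obtain ⟨b, hb⟩ := hy
    exact ⟨a + b, by rw [map_add, map_add, ha, hb]⟩
  | mul x y _ _ hx hy =>
    obtain ⟨a, ha⟩ := hx
    obtain ⟨b, hb⟩ := hy
    exact ⟨a * b, by rw [map_mul, map_mul, ha, hb]⟩

lemma pow_mul_le_of_mul_le {R S : Type*} [CommSemiring R] [CommSemiring S] [Algebra R S]
    {V : Submodule R S} {c : ℕ → Submodule R S} (hst : ∀ n, V * c n ≤ c (n + 1)) (m n : ℕ) :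
    V ^ m * c n ≤ c (m + n) := by
  induction m generalizing n with
  | zero => simp
  | succ m ih =>
    rw [pow_succ, mul_assoc, show m + 1 + n = m + (n + 1) by ring]
    exact (mul_le_mul_right (hst n) _).trans (ih (n + 1))

/-- Avoidance, in a single degree, of the minimal primes `P` of `I` with `dim D / P > d`. -/
lemma exists_mem_avoiding [Infinite k] [IsNoetherianRing D] {V : Submodule k D}
    (htop : Algebra.adjoin k (V : Set D) = ⊤) {c : ℕ → Submodule k D}
    (hst : ∀ n, V * c n ≤ c (n + 1)) {d : ℕ}
    (hd : ringKrullDim (D ⧸ Ideal.span (⋃ n, (c n : Set D))) ≤ d) (I : Ideal D) :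
    ∃ n, 1 ≤ n ∧ ∃ x ∈ c n, ∀ P ∈ I.minimalPrimes, x ∈ P → ringKrullDim (D ⧸ P) ≤ d := by
  let Bad : Set (Ideal D) := {P ∈ I.minimalPrimes | ¬ ringKrullDim (D ⧸ P) ≤ d}
  have hfin : Finite Bad :=
    ((Ideal.finite_minimalPrimes_of_isNoetherianRing D I).subset fun P hP => hP.1).to_subtype
  -- A bad prime omits some `f` in some `c m`, by the dimension hypothesis, and some `z` in `V`. The
  -- products `z^e * f` avoid it in all higher degrees, so one degree `N` serves all bad primes.
  have key : ∀ P : Bad, ∃ m, ∀ n, m ≤ n → ∃ f ∈ c n, f ∉ P.1 := by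
    rintro ⟨P, hP, hPd⟩
    have hprime : P.IsPrime := hP.1.1
    obtain ⟨z, hz, hzP⟩ : ∃ z ∈ V, z ∉ P := by
      by_contra! h
      exact hPd ((ringKrullDim_quotient_le_zero_of_le htop h).trans (by exact_mod_cast d.zero_le))
    obtain ⟨m, f, hf, hfP⟩ : ∃ m, ∃ f ∈ c m, f ∉ P := by
      by_contra! h
      exact hPd ((ringKrullDim_quotient_mono (Ideal.span_le.2
        (Set.iUnion_subset fun n x hx => h n x hx))).trans hd)
    refine ⟨m, fun n hn => ?_⟩
    obtain ⟨e, rfl⟩ := Nat.exists_eq_add_of_le' hn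
    refine ⟨z ^ e * f, pow_mul_le_of_mul_le hst e m
      (Submodule.mul_mem_mul (Submodule.pow_mem_pow _ hz e) hf), fun h => ?_⟩
    rcases hprime.mem_or_mem h with h | h
    exacts [hzP (hprime.mem_of_pow_mem _ h), hfP h]
  choose m hm using key
  have := Fintype.ofFinite Bad
  let N := ∑ P, m P + 1
  have hN : ∀ P, m P ≤ N := fun P =>
    (Finset.single_le_sum (fun _ _ => Nat.zero_le _) (Finset.mem_univ P)).trans (Nat.le_succ _)
  by_contra! hcon
  -- A vector space over an infinite field is not a finite union of proper subspaces.
  obtain ⟨P, hP⟩ := Subspace.exists_eq_top_of_iUnion_eq_univ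
    (p := fun P : Bad => (P.1.restrictScalars k).submoduleOf (c N)) (by
      refine Set.eq_univ_of_forall fun x => ?_
      obtain ⟨P, hP, hxP, hPd⟩ := hcon N (Nat.succ_le_succ (Nat.zero_le _)) x x.2
      exact Set.mem_iUnion.2 ⟨⟨P, hP, not_le.2 hPd⟩, hxP⟩)
  obtain ⟨f, hf, hfP⟩ := hm P N (hN P)
  have : (⟨f, hf⟩ : c N) ∈ (P.1.restrictScalars k).submoduleOf (c N) := hP ▸ Submodule.mem_top
  exact hfP this

/-- Parameters are chosen from the highest index down: with remaining dimension at most `j + 1`, an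
element of `c j` avoiding the minimal primes of dimension above `j` lowers the bound to `j`. -/
lemma exists_parameters_aux [Infinite k] [IsNoetherianRing D] {V : Submodule k D}
    (htop : Algebra.adjoin k (V : Set D) = ⊤) (c : ℕ → ℕ → Submodule k D)
    (hst : ∀ j n, V * c j n ≤ c j (n + 1)) (d : ℕ) :
    ∀ I : Ideal D, ringKrullDim (D ⧸ I) ≤ d →
      (∀ j < d, ringKrullDim (D ⧸ Ideal.span (⋃ n, (c j n : Set D))) ≤ j) →
      ∃ (x : ℕ → D) (e : ℕ → ℕ), (∀ j < d, 1 ≤ e j ∧ x j ∈ c j (e j)) ∧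
        ringKrullDim (D ⧸ (I ⊔ Ideal.span (x '' Set.Iio d))) ≤ 0 := by
  induction d with
  | zero => exact fun I hI _ => ⟨0, 0, by simp,
      (ringKrullDim_quotient_mono le_sup_left).trans (by simpa using hI)⟩
  | succ d ih =>
    intro I hI hc
    obtain ⟨n, hn, x₀, hx₀, hav⟩ := exists_mem_avoiding htop (hst d) (hc d d.lt_succ_self) I
    obtain ⟨x, e, hx, hdim⟩ := ih (I ⊔ Ideal.span {x₀}) (ringKrullDim_quotient_sup_span_le hI hav)
      fun j hj => hc j (hj.trans d.lt_succ_self)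
    refine ⟨Function.update x d x₀, Function.update e d n, fun j hj => ?_, ?_⟩
    · rcases Nat.lt_succ_iff_lt_or_eq.1 hj with hj | rfl
      · simpa [Function.update_of_ne hj.ne] using hx j hj
      · simpa using ⟨hn, hx₀⟩
    · refine (ringKrullDim_quotient_mono ?_).trans hdim
      rw [sup_assoc]
      refine sup_le_sup_left (sup_le ?_ ?_) I
      · exact Ideal.span_mono (Set.singleton_subset_iff.2 ⟨d, by simp, by simp⟩)
      · refine Ideal.span_mono ?_
        rintro _ ⟨j, hj, rfl⟩
        exact ⟨j, lt_trans hj d.lt_succ_self, Function.update_of_ne (ne_of_lt hj) _ _⟩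

/-- Existence of a homogeneous system of parameters, all of the same degree, whose members lie in
prescribed homogeneous ideals. -/
theorem exists_parameters [Infinite k] {V : Submodule k D} (hV : V.FG)
    (htop : Algebra.adjoin k (V : Set D) = ⊤) {s : ℕ} (hdim : ringKrullDim D ≤ s)
    (c : ℕ → ℕ → Submodule k D) (hle : ∀ j n, c j n ≤ V ^ n)
    (hst : ∀ j n, V * c j n ≤ c j (n + 1))
    (hc : ∀ j < s, ringKrullDim (D ⧸ Ideal.span (⋃ n, (c j n : Set D))) ≤ j) :
    ∃ n, 1 ≤ n ∧ ∃ x : Fin s → D, (∀ i : Fin s, x i ∈ c i n) ∧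
      Module.Finite k (D ⧸ Ideal.span (Set.range x)) := by
  have := finiteType_of_adjoin_eq_top hV htop
  have : IsNoetherianRing D := Algebra.FiniteType.isNoetherianRing k D
  obtain ⟨x, e, hx, hx0⟩ := exists_parameters_aux htop c hst s ⊥
    ((ringKrullDim_quotient_le ⊥).trans hdim) hc
  rw [bot_sup_eq] at hx0
  -- Powers of the parameters bring them to the common degree `n` without changing which primes
  -- contain them.
  let n := ∏ j ∈ Finset.range s, e j
  have hn : ∀ j < s, ∃ t, n = t * e j + e j := fun j hj => by
    obtain ⟨t, ht⟩ := Finset.dvd_prod_of_mem e (Finset.mem_range.2 hj)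
    have hn0 : n ≠ 0 := Finset.prod_ne_zero_iff.2 fun i hi =>
      Nat.one_le_iff_ne_zero.1 (hx i (Finset.mem_range.1 hi)).1
    obtain ⟨t, rfl⟩ : ∃ t', t = t' + 1 := Nat.exists_eq_succ_of_ne_zero (by
      rintro rfl
      exact hn0 (by simpa using ht))
    exact ⟨t, by change ∏ j ∈ Finset.range s, e j = _; rw [ht]; ring⟩
  choose! t ht using hn
  refine ⟨n, Nat.one_le_iff_ne_zero.2 (Finset.prod_ne_zero_iff.2 fun i hi =>
      Nat.one_le_iff_ne_zero.1 (hx i (Finset.mem_range.1 hi)).1),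
    fun i => x i ^ (t i + 1), fun i => ?_, ?_⟩
  · have hxi := (hx i i.2).2
    beta_reduce
    rw [ht i i.2, pow_succ]
    refine pow_mul_le_of_mul_le (hst i) _ _ (Submodule.mul_mem_mul ?_ hxi)
    have := Submodule.pow_mem_pow _ (hle _ _ hxi) (t i)
    rwa [← pow_mul, mul_comm] at this
  · rw [Module.finite_iff_krullDimLE_zero, Ring.KrullDimLE, Order.krullDimLE_iff]
    have hx0' : ringKrullDim (D ⧸ Ideal.span (x '' Set.Iio s)) ≤ (0 : ℕ) := by simpa using hx0
    change ringKrullDim _ ≤ _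
    rw [ringKrullDim_quotient_le_iff] at hx0' ⊢
    refine fun l hl => hx0' l (Ideal.span_le.2 ?_)
    rintro _ ⟨j, hj, rfl⟩
    exact l.head.2.mem_of_pow_mem _ (hl (Ideal.subset_span ⟨⟨j, hj⟩, rfl⟩))

end PrimeAvoidance

lemma adjoin_map_eq_top {R A D : Type*} [CommRing R] [CommRing A] [Algebra R A] [CommRing D]
    [Algebra R D] {W : Submodule R A} (hW : Algebra.adjoin R (W : Set A) = ⊤)
    {f : A →ₐ[R] D} (hf : Function.Surjective f) :
    Algebra.adjoin R (W.map f.toLinearMap : Set D) = ⊤ := by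
  rw [Submodule.map_coe]
  change Algebra.adjoin R (f '' W) = ⊤
  rw [← AlgHom.map_adjoin, hW, Algebra.map_top, AlgHom.range_eq_top]
  exact hf

/-! ### Parameters of the fiber cone and their lifts -/

section FiberCone

open IsLocalRing

variable {R A D : Type*} [CommRing R] [IsLocalRing R] [CommRing A] [Algebra R A]
  [CommRing D] [Algebra R D] [Algebra (ResidueField R) D] [IsScalarTower R (ResidueField R) D]

/-- As `R` surjects onto its residue field, `R`-submodules of `D` are already subspaces; lengths
over `R` thus become dimensions. -/
lemma restrictScalars_span_residueField (X : Submodule R D) :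
    (Submodule.span (ResidueField R) (X : Set D)).restrictScalars R = X := by
  rw [Submodule.restrictScalars_span R (ResidueField R) residue_surjective, Submodule.span_eq]

lemma mem_span_residueField {X : Submodule R D} {x : D} :
    x ∈ Submodule.span (ResidueField R) (X : Set D) ↔ x ∈ X := by
  conv_rhs => rw [← restrictScalars_span_residueField X]
  rfl

lemma span_residueField_pow (X : Submodule R D) (n : ℕ) :
    Submodule.span (ResidueField R) (X : Set D) ^ n =
      Submodule.span (ResidueField R) ((X ^ n : Submodule R D) : Set D) := by
  refine (Submodule.restrictScalars_injective R _ _ ?_)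
  conv_rhs => rw [restrictScalars_span_residueField]
  rw [Submodule.span_pow, Submodule.restrictScalars_span R (ResidueField R) residue_surjective,
    ← Submodule.span_pow, Submodule.span_eq]

lemma adjoin_residueField_eq_top {X : Submodule R D}
    (h : Algebra.adjoin R (X : Set D) = ⊤) :
    Algebra.adjoin (ResidueField R)
      (Submodule.span (ResidueField R) (X : Set D) : Set D) = ⊤ := by
  rw [Algebra.adjoin_span, eq_top_iff]
  have : Algebra.adjoin R (X : Set D) ≤
      (Algebra.adjoin (ResidueField R) (X : Set D)).restrictScalars R :=
    Algebra.adjoin_le Algebra.subset_adjoin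
  exact fun x _ => this (h ▸ Algebra.mem_top)

lemma fg_span_residueField {X : Submodule R D} (h : X.FG) :
    (Submodule.span (ResidueField R) (X : Set D)).FG := by
  obtain ⟨s, rfl⟩ := h
  exact ⟨s, by rw [Submodule.span_span_of_tower]⟩

/-- The dimension of an algebra over the residue field, in terms of lengths. -/
lemma ringKrullDim_le_of_sum_relLength_le {W : Submodule R A} (hW : W.FG)
    (htop : Algebra.adjoin R (W : Set A) = ⊤) {f : A →ₐ[R] D} (hf : Function.Surjective f)
    {Z : ℕ → Submodule R A} (hZ : ∀ n, ∀ z ∈ Z n, f z = 0)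
    (hfin : ∀ n, relLength (W ^ n) (Z n) ≠ ⊤) {C d : ℕ}
    (hC : ∀ n, ∑ m ∈ Finset.range (n + 1), (relLength (W ^ m) (Z m)).toNat ≤ C * (n + 1) ^ d) :
    ringKrullDim D ≤ d := by
  refine ringKrullDim_le_of_sum_finrank_le (fg_span_residueField (hW.map f.toLinearMap))
    (adjoin_residueField_eq_top (adjoin_map_eq_top htop hf)) fun n =>
      (Finset.sum_le_sum fun m _ => ?_).trans (hC n)
  rw [span_residueField_pow, ← Submodule.map_pow]
  set X : Submodule R D := (W ^ m).map f.toLinearMap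
  set U := Submodule.span (ResidueField R) (X : Set D)
  have hUfin : Module.Finite (ResidueField R) U :=
    Module.Finite.iff_fg.2 (fg_span_residueField ((hW.pow m).map _))
  have h1 : (Module.finrank (ResidueField R) U : ℕ∞) = Module.length R X := by
    rw [← Module.length_eq_finrank, ← Module.length_eq_of_surjective (S := R) residue_surjective]
    exact LinearEquiv.length_eq (LinearEquiv.ofEq (U.restrictScalars R) X
      (restrictScalars_span_residueField X))
  have h2 : Module.length R X ≤ relLength (W ^ m) (Z m) := by
    rw [← relLength_bot]
    have h3 : (Z m).map f.toLinearMap = ⊥ := by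
      rw [← le_bot_iff, Submodule.map_le_iff_le_comap]
      exact fun z hz => hZ m z hz
    rw [← h3]
    exact relLength_map_le _ _ _
  have h3 := ENat.toNat_le_toNat (h1.le.trans h2) (hfin m)
  rwa [ENat.toNat_natCast] at h3

end FiberCone

lemma top_eq_iSup_pow {R A : Type*} [CommRing R] [CommRing A] [Algebra R A] {W : Submodule R A}
    (htop : Algebra.adjoin R (W : Set A) = ⊤) : (⊤ : Submodule R A) = ⨆ n, W ^ n := by
  have hle : ∀ n, W ^ n ≤ ⨆ n, W ^ n := le_iSup _
  refine (eq_top_iff.2 fun a _ => ?_).symm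
  have ha : a ∈ Algebra.adjoin R (W : Set A) := htop ▸ Algebra.mem_top
  induction ha using Algebra.adjoin_induction with
  | mem a ha => exact hle 1 (by rwa [pow_one])
  | algebraMap r => exact hle 0 (by rw [pow_zero]; exact Submodule.algebraMap_mem r)
  | add a b _ _ ha hb => exact add_mem (ha trivial) (hb trivial)
  | mul a b _ _ ha hb =>
    have hmul : (⨆ n, W ^ n) * (⨆ n, W ^ n) ≤ ⨆ n, W ^ n := by
      rw [Submodule.iSup_mul]
      refine iSup_le fun m => ?_
      rw [Submodule.mul_iSup]
      exact iSup_le fun n => by rw [← pow_add]; exact hle _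
    exact hmul (Submodule.mul_mem_mul (ha trivial) (hb trivial))

section FiberConeParameters

open IsLocalRing

variable {R A D : Type*} [CommRing R] [IsLocalRing R] [CommRing A] [Algebra R A]
  [CommRing D] [Algebra R D] [Algebra (ResidueField R) D] [IsScalarTower R (ResidueField R) D]

/-- The growth bound makes the quotient of `D` by the image of `Z` have dimension at most `s - k`,
so `Z` is an admissible source for every parameter of index `j ≥ s - k`. -/
theorem exists_parameters_of_sum_relLength_le [Infinite (ResidueField R)] {W : Submodule R A}
    (hW : W.FG) (htop : Algebra.adjoin R (W : Set A) = ⊤) {f : A →ₐ[R] D}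
    (hf : Function.Surjective f) {s k : ℕ} (hdim : ringKrullDim D ≤ s)
    {Z : ℕ → Submodule R A} (hle : ∀ n, Z n ≤ W ^ n) (hst : ∀ n, W * Z n ≤ Z (n + 1))
    (hfin : ∀ n, relLength (W ^ n) (Z n) ≠ ⊤) {C : ℕ}
    (hC : ∀ n, ∑ m ∈ Finset.range (n + 1), (relLength (W ^ m) (Z m)).toNat ≤
      C * (n + 1) ^ (s - k)) :
    ∃ n, 1 ≤ n ∧ ∃ x : Fin s → A, (∀ i, x i ∈ W ^ n) ∧ (∀ i : Fin s, (i : ℕ) < k → x i ∈ Z n) ∧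
      Module.Finite (ResidueField R) (D ⧸ Ideal.span (Set.range fun i => f (x i))) := by
  let U : Submodule R A → Submodule (ResidueField R) D := fun X =>
    Submodule.span (ResidueField R) (X.map f.toLinearMap : Set D)
  have hU : ∀ {X : Submodule R A} {y : D}, y ∈ U X ↔ ∃ z ∈ X, f z = y := fun {X y} => by
    rw [mem_span_residueField]
    rfl
  have hUpow : ∀ n, U W ^ n = U (W ^ n) := fun n => by
    rw [span_residueField_pow, ← Submodule.map_pow]
  have hUmono : ∀ {X Y : Submodule R A}, X ≤ Y → U X ≤ U Y := fun h =>
    Submodule.span_mono (Submodule.map_mono h)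
  have hUmul : ∀ X, U W * U X ≤ U (W * X) := fun X => Submodule.mul_le.2 fun a ha b hb => by
    obtain ⟨a', ha', rfl⟩ := hU.1 ha
    obtain ⟨b', hb', rfl⟩ := hU.1 hb
    exact hU.2 ⟨a' * b', Submodule.mul_mem_mul ha' hb', map_mul _ _ _⟩
  -- For `j < s - k` the prescribed ideal is the unit ideal, which imposes no condition.
  let c : ℕ → ℕ → Submodule (ResidueField R) D := fun j n =>
    if s - k ≤ j then U (Z n) else U (W ^ n)
  obtain ⟨n, hn, x, hx, hfinite⟩ := exists_parameters (V := U W)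
    (fg_span_residueField (hW.map f.toLinearMap))
    (adjoin_residueField_eq_top (adjoin_map_eq_top htop hf)) hdim c
    (fun j n => by
      dsimp only [c]
      rw [hUpow]
      split_ifs
      exacts [hUmono (hle n), le_rfl])
    (fun j n => by
      dsimp only [c]
      split_ifs
      · exact (hUmul _).trans (hUmono (hst n))
      · exact (hUmul _).trans (hUmono (by rw [pow_succ'])))
    (fun j hj => by
      set J := Ideal.span (⋃ n, (c j n : Set D)) with hJ
      by_cases h : s - k ≤ j
      · refine (ringKrullDim_le_of_sum_relLength_le (d := s - k) hW htop
          (f := (Ideal.Quotient.mkₐ R J).comp f)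
          (Ideal.Quotient.mk_surjective.comp hf) (Z := Z) (fun n z hz => ?_) hfin hC).trans
            (by exact_mod_cast h)
        refine Ideal.Quotient.eq_zero_iff_mem.2 (Ideal.subset_span (Set.mem_iUnion.2 ⟨n, ?_⟩))
        simp only [c, if_pos h]
        exact hU.2 ⟨z, hz, rfl⟩
      · have h1 : J = ⊤ := by
          rw [Ideal.eq_top_iff_one]
          refine Ideal.subset_span (Set.mem_iUnion.2 ⟨0, ?_⟩)
          simp only [c, if_neg h]
          exact hU.2 ⟨1, by rw [pow_zero]; exact Submodule.one_le.1 le_rfl, map_one f⟩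
        have : Subsingleton (D ⧸ J) := Ideal.Quotient.subsingleton_iff.2 h1
        simp [ringKrullDim_eq_bot_of_subsingleton])
  have hlift : ∀ i : Fin s, ∃ a ∈ W ^ n, (s - k ≤ (i : ℕ) → a ∈ Z n) ∧ f a = x i := fun i => by
    have hxi := hx i
    dsimp only [c] at hxi
    split_ifs at hxi with h
    · obtain ⟨a, ha, hax⟩ := hU.1 hxi
      exact ⟨a, hle n ha, fun _ => ha, hax⟩
    · obtain ⟨a, ha, hax⟩ := hU.1 hxi
      exact ⟨a, ha, fun h' => absurd h' h, hax⟩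
  choose a haW haZ hax using hlift
  -- The members from `Z` carry the last `k` indices; reversing the order puts them first.
  refine ⟨n, hn, fun i => a i.rev, fun i => haW _, fun i hi => haZ _ ?_, ?_⟩
  · rw [Fin.val_rev]
    omega
  · have : (Set.range fun i => f (a (Fin.rev i))) = Set.range x := by
      ext y
      simp only [hax, Set.mem_range]
      exact ⟨fun ⟨i, hi⟩ => ⟨_, hi⟩, fun ⟨i, hi⟩ => ⟨i.rev, by rw [Fin.rev_rev, hi]⟩⟩
    rw [this]
    exact hfinite

/-- Lifting of a system of parameters of the fiber cone to the graded algebra `A`, whose grading is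
given by the projections `π`. -/
theorem exists_pow_le_of_finite {W : Submodule R A}
    (htop : Algebra.adjoin R (W : Set A) = ⊤) {π : ℕ → A →ₗ[R] A}
    (hπ : ∀ n, ∀ a ∈ W ^ n, π n a = a) (hπ' : ∀ m n, m ≠ n → ∀ a ∈ W ^ m, π n a = 0)
    {f : A →ₐ[R] D} (hf : Function.Surjective f)
    (hker : ∀ a, f a = 0 → a ∈ maximalIdeal R • (⊤ : Submodule R A)) {ι : Type*} [Fintype ι]
    {d : ℕ} {x : ι → A} (hx : ∀ i, x i ∈ W ^ d)
    (hfin : Module.Finite (ResidueField R) (D ⧸ Ideal.span (Set.range fun i => f (x i)))) :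
    ∃ c, ∀ n, c ≤ n → W ^ (n + d) ≤
      Submodule.span R (Set.range x) * W ^ n ⊔ maximalIdeal R • W ^ (n + d) := by
  set J := Ideal.span (Set.range fun i => f (x i))
  have hsup := top_eq_iSup_pow htop
  have hπtop : ∀ n a, π n a ∈ W ^ n := fun n a => by
    have ha : a ∈ ⨆ n, W ^ n := hsup ▸ Submodule.mem_top
    induction ha using Submodule.iSup_induction' with
    | mem m a ha =>
      by_cases h : m = n
      · subst h
        rwa [hπ m a ha]
      · rw [hπ' m n h a ha]
        exact zero_mem _
    | zero => simp
    | add a b _ _ ha hb => rw [map_add]; exact add_mem ha hb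
  have hπmul : ∀ i n a, π (n + d) (x i * a) ∈ Submodule.span R (Set.range x) * W ^ n :=
    fun i n a => by
    have ha : a ∈ ⨆ n, W ^ n := hsup ▸ Submodule.mem_top
    induction ha using Submodule.iSup_induction' with
    | mem m a ha =>
      have hxa : x i * a ∈ W ^ (m + d) := by
        rw [add_comm, pow_add]
        exact Submodule.mul_mem_mul (hx i) ha
      by_cases h : m = n
      · subst h
        rw [hπ _ _ hxa]
        exact Submodule.mul_mem_mul (Submodule.subset_span ⟨i, rfl⟩) ha
      · rw [hπ' (m + d) (n + d) (by omega) _ hxa]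
        exact zero_mem _
    | zero => simp
    | add a b _ _ ha hb => rw [mul_add, map_add]; exact add_mem ha hb
  have hπm : ∀ n, ∀ a ∈ maximalIdeal R • (⊤ : Submodule R A), π n a ∈ maximalIdeal R • W ^ n := by
    intro n a ha
    have h1 := Submodule.mem_map_of_mem (f := π n) ha
    rw [Submodule.map_smul''] at h1
    refine Submodule.smul_mono le_rfl ?_ h1
    rintro _ ⟨b, -, rfl⟩
    exact hπtop n b
  let U := Submodule.span (ResidueField R) (W.map f.toLinearMap : Set D)
  have hUtop : Algebra.adjoin (ResidueField R) (U : Set D) = ⊤ :=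
    adjoin_residueField_eq_top (adjoin_map_eq_top htop hf)
  have hUpow : ∀ n (y : D), y ∈ U ^ n ↔ ∃ z ∈ W ^ n, f z = y := fun n y => by
    rw [span_residueField_pow, ← Submodule.map_pow, mem_span_residueField]
    rfl
  let g := (Ideal.Quotient.mkₐ (ResidueField R) J).toLinearMap
  -- Since `D / J` is finite-dimensional, the images of the filtration stabilize at some `c`. An
  -- element of degree above `c` is then congruent modulo `J` to one of degree at most `c`, and
  -- projecting to the top degree removes the latter.
  let Y : ℕ →o Submodule (ResidueField R) (D ⧸ J) :=
    { toFun := fun n => ((1 ⊔ U) ^ n).map g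
      monotone' := fun m n h => Submodule.map_mono (pow_le_pow_one_sup U h) }
  obtain ⟨c, hc⟩ := monotone_stabilizes_iff_noetherian.2
    (inferInstance : IsNoetherian (ResidueField R) (D ⧸ J)) Y
  refine ⟨c + 1, fun n hn u hu => ?_⟩
  have hfu : g (f u) ∈ Y c := by
    rw [hc (n + d) (by omega)]
    refine Submodule.mem_map_of_mem (pow_le_pow_left' (le_sup_right : U ≤ 1 ⊔ U) _ ?_)
    exact (hUpow _ _).2 ⟨u, hu, rfl⟩
  obtain ⟨w, hw, hwu⟩ := hfu
  obtain ⟨b, hb, hbw⟩ : ∃ b, π (n + d) b = 0 ∧ f b = w := by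
    have hw' := one_sup_pow_le U c hw
    have key : ∀ y ∈ ⨆ i ∈ Finset.range (c + 1), U ^ i, ∃ b, π (n + d) b = 0 ∧ f b = y := by
      intro y hy
      induction hy using Submodule.iSup_induction' with
      | mem m y hy =>
        by_cases hm : m ∈ Finset.range (c + 1)
        · rw [iSup_pos hm] at hy
          obtain ⟨b, hb, rfl⟩ := (hUpow _ _).1 hy
          exact ⟨b, hπ' m _ (by have := Finset.mem_range.1 hm; omega) b hb, rfl⟩
        · rw [iSup_neg hm, Submodule.mem_bot] at hy
          exact ⟨0, map_zero _, by rw [map_zero, hy]⟩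
      | zero => exact ⟨0, map_zero _, map_zero _⟩
      | add y z _ _ hy hz =>
        obtain ⟨b, hb, rfl⟩ := hy
        obtain ⟨b', hb', rfl⟩ := hz
        exact ⟨b + b', by rw [map_add, hb, hb', add_zero], map_add _ _ _⟩
    exact key w hw'
  have hJ : f u - f b ∈ J := by
    rw [hbw]
    exact Ideal.Quotient.eq.1 hwu.symm
  obtain ⟨y, hy⟩ := Ideal.mem_span_range_iff_exists_fun.1 hJ
  choose z hz using fun i => hf (y i)
  have hmem : u - b - ∑ i, x i * z i ∈ maximalIdeal R • (⊤ : Submodule R A) := by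
    refine hker _ ?_
    rw [map_sub, map_sub, ← hy, map_sum, sub_eq_zero]
    exact Finset.sum_congr rfl fun i _ => by rw [map_mul, hz, mul_comm]
  have h1 := hπm (n + d) _ hmem
  rw [map_sub, map_sub, hπ _ _ hu, hb, sub_zero, map_sum] at h1
  have h2 : ∑ i, π (n + d) (x i * z i) ∈ Submodule.span R (Set.range x) * W ^ n :=
    sum_mem fun i _ => hπmul i n _
  have h3 := Submodule.add_mem_sup h2 h1
  rwa [add_sub_cancel] at h3

end FiberConeParameters

/-! ### Reductions of powers and their generators -/

section Reductions

variable {R S : Type*} [CommRing R] [CommRing S] [Algebra R S]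

lemma isReduction_pow_of_le {N V : Submodule R S} {c d : ℕ} (hd : 1 ≤ d) (hN : N ≤ V ^ d)
    (h : ∀ n, c ≤ n → V ^ (n + d) ≤ N * V ^ n) : IsReduction N (V ^ d) := by
  refine ⟨hN, c + 1, Nat.succ_pos c, fun n hn => ?_⟩
  refine le_antisymm ?_ (by rw [pow_succ']; exact mul_le_mul_left hN _)
  rw [← pow_mul, ← pow_mul, mul_add, mul_one]
  exact h _ (by nlinarith)

/-- Multiplying one equality `V^(dc+d) = N V^(dc)` by `V^e` covers every exponent `dc + e`, not only
multiples of `d`. -/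
lemma IsReduction.exists_pow_le {N V : Submodule R S} {d : ℕ} (h : IsReduction N (V ^ d)) :
    ∃ c, ∀ n, c ≤ n → V ^ (n + d) ≤ N * V ^ n := by
  obtain ⟨-, c, -, hc⟩ := h
  refine ⟨d * c, fun n hn => ?_⟩
  obtain ⟨e, rfl⟩ := Nat.exists_eq_add_of_le hn
  have h1 := hc c le_rfl
  rw [← pow_mul, ← pow_mul, mul_add, mul_one] at h1
  rw [show d * c + e + d = d * c + d + e by ring, pow_add V _ e, h1, pow_add V _ e, mul_assoc]

variable [IsLocalRing R]

/-- A submodule of `X = ⟨x₁, …, xₛ⟩` that does not generate `X` is generated, up to `𝔪 X`, by fewer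
than `s` elements. -/
lemma exists_lt_span {E : Type*} [AddCommGroup E] [Module R E] {s : ℕ} (x : Fin s → E)
    {N : Submodule R E} (hN : N ≤ Submodule.span R (Set.range x))
    (hne : ¬ Submodule.span R (Set.range x) ≤
      N ⊔ IsLocalRing.maximalIdeal R • Submodule.span R (Set.range x)) :
    ∃ d < s, ∃ y : Fin d → E, (∀ i, y i ∈ N) ∧ N ≤ Submodule.span R (Set.range y) ⊔
      IsLocalRing.maximalIdeal R • Submodule.span R (Set.range x) := by
  set X := Submodule.span R (Set.range x) with hX
  set 𝔪 := IsLocalRing.maximalIdeal R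
  let _ : Field (R ⧸ 𝔪) := Ideal.Quotient.field 𝔪
  let p := (𝔪 • ⊤ : Submodule R X).mkQ
  have hsurj : Function.Surjective (algebraMap R (R ⧸ 𝔪)) := Ideal.Quotient.mk_surjective
  have hspan : ∀ Y : Submodule R X,
      (Submodule.span (R ⧸ 𝔪) (Y.map p : Set (X ⧸ (𝔪 • ⊤ : Submodule R X)))).restrictScalars R =
        Y.map p := fun Y => by
    rw [Submodule.restrictScalars_span R (R ⧸ 𝔪) hsurj, Submodule.span_eq]
  let x' : Fin s → X := fun i => ⟨x i, Submodule.subset_span ⟨i, rfl⟩⟩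
  have hx' : Submodule.span R (Set.range x') = ⊤ := by
    refine (Submodule.map_injective_of_injective X.subtype_injective) ?_
    rw [Submodule.map_span, Submodule.map_top, Submodule.range_subtype, ← Set.range_comp]
    rfl
  have hmap : ((𝔪 • ⊤ : Submodule R X)).map X.subtype = 𝔪 • X := by
    rw [Submodule.map_smul'', Submodule.map_top, Submodule.range_subtype]
  have htop : Submodule.span (R ⧸ 𝔪) (Set.range fun i => p (x' i)) = ⊤ := by
    refine Submodule.restrictScalars_injective R _ _ ?_
    rw [Submodule.restrictScalars_span R (R ⧸ 𝔪) hsurj, Submodule.restrictScalars_top]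
    change Submodule.span R (Set.range (p ∘ x')) = ⊤
    rw [Set.range_comp, ← Submodule.map_span, hx', Submodule.map_top, Submodule.range_mkQ]
  have hfin : Module.Finite (R ⧸ 𝔪) (X ⧸ (𝔪 • ⊤ : Submodule R X)) :=
    ⟨⟨(Set.finite_range fun i => p (x' i)).toFinset, by simpa using htop⟩⟩
  have hle : Module.finrank (R ⧸ 𝔪) (X ⧸ (𝔪 • ⊤ : Submodule R X)) ≤ s := by
    have := finrank_range_le_card (R := R ⧸ 𝔪) (fun i => p (x' i))
    rwa [Set.finrank, htop, finrank_top, Fintype.card_fin] at this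
  set N' := N.submoduleOf X
  set U := Submodule.span (R ⧸ 𝔪) (N'.map p : Set (X ⧸ (𝔪 • ⊤ : Submodule R X)))
  -- The image of `N` in `X / 𝔪 X` is a proper subspace of a space of dimension at most `s`; a basis
  -- of it lifts to `N`.
  have hUtop : U ≠ ⊤ := by
    intro h
    refine hne ?_
    have h1 : N'.map p = ⊤ := by
      rw [← hspan N']
      exact (congrArg (Submodule.restrictScalars R) h).trans (Submodule.restrictScalars_top _ _ _)
    intro z hz
    have h2 : p ⟨z, hz⟩ ∈ N'.map p := h1 ▸ Submodule.mem_top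
    obtain ⟨w, hw, hwz⟩ := h2
    have h3 : (⟨z, hz⟩ : X) - w ∈ (𝔪 • ⊤ : Submodule R X) := (Submodule.Quotient.eq _).1 hwz.symm
    have h4 := Submodule.mem_map_of_mem (f := X.subtype) h3
    rw [hmap] at h4
    have h5 := Submodule.add_mem_sup (show (w : E) ∈ N from hw) h4
    simpa using h5
  have hlt := Submodule.finrank_lt hUtop
  let b := Module.finBasis (R ⧸ 𝔪) U
  have hb : ∀ i, ∃ y ∈ N', p y = b i := fun i => by
    have h1 : (b i : X ⧸ (𝔪 • ⊤ : Submodule R X)) ∈ U.restrictScalars R := (b i).2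
    rw [hspan] at h1
    exact h1
  choose y hyN hy using hb
  refine ⟨_, hlt.trans_le hle, fun i => y i, hyN, fun z hz => ?_⟩
  have hrange : U = Submodule.span (R ⧸ 𝔪) (Set.range (p ∘ y)) := by
    have h1 := congrArg (Submodule.map U.subtype) b.span_eq
    rw [Submodule.map_span, Submodule.map_top, Submodule.range_subtype, ← Set.range_comp] at h1
    have hcomp : U.subtype ∘ b = p ∘ y := funext fun i => (hy i).symm
    rw [hcomp] at h1
    exact h1.symm
  have h1 : p ⟨z, hN hz⟩ ∈ U.restrictScalars R := by
    rw [hspan]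
    exact Submodule.mem_map_of_mem (show (⟨z, hN hz⟩ : X) ∈ N' from hz)
  rw [hrange, Submodule.restrictScalars_span R (R ⧸ 𝔪) hsurj, Set.range_comp,
    ← Submodule.map_span] at h1
  obtain ⟨w, hw, hwz⟩ := h1
  have h3 : (⟨z, hN hz⟩ : X) - w ∈ (𝔪 • ⊤ : Submodule R X) := (Submodule.Quotient.eq _).1 hwz.symm
  have h4 := Submodule.mem_map_of_mem (f := X.subtype) h3
  rw [hmap] at h4
  have h6 := Submodule.mem_map_of_mem (f := X.subtype) hw
  rw [Submodule.map_span, ← Set.range_comp] at h6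
  have h5 := Submodule.add_mem_sup h6 h4
  simpa [Function.comp_def] using h5

end Reductions

/-! ### The grading of the symmetric algebra -/

section SymGrading

variable (R F : Type*) [CommRing R] [AddCommGroup F] [Module R F]

/-- The algebra homomorphism `Sym(F) → Sym(F)[T]` recording the degree. -/
def symDegree : SymmetricAlgebra R F →ₐ[R] (SymmetricAlgebra R F)[X] :=
  SymmetricAlgebra.lift
    (((monomial 1 : SymmetricAlgebra R F →ₗ[SymmetricAlgebra R F] _).restrictScalars R) ∘ₗ
      SymmetricAlgebra.ι R F)

/-- The projection of `Sym(F)` to its component of degree `n`. -/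
def symProj (n : ℕ) : SymmetricAlgebra R F →ₗ[R] SymmetricAlgebra R F :=
  ((lcoeff (SymmetricAlgebra R F) n).restrictScalars R) ∘ₗ (symDegree R F).toLinearMap

variable {R F} (M : Submodule R F)

lemma symDegree_of_mem {n : ℕ} {x : SymmetricAlgebra R F} (hx : x ∈ modPow M n) :
    symDegree R F x = monomial n x := by
  induction n generalizing x with
  | zero =>
    rw [modPow, pow_zero, Submodule.mem_one] at hx
    obtain ⟨r, rfl⟩ := hx
    rw [AlgHom.commutes]
    rfl
  | succ n ih =>
    rw [modPow, pow_succ] at hx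
    induction hx using Submodule.mul_induction_on' with
    | mem_mul_mem a ha b hb =>
      obtain ⟨v, hv, rfl⟩ := hb
      rw [map_mul, ih ha, symDegree, SymmetricAlgebra.lift_ι_apply]
      exact monomial_mul_monomial _ _ _ _
    | add x _ y _ hx hy => rw [map_add, map_add, hx, hy]

lemma symProj_of_mem {n : ℕ} {x : SymmetricAlgebra R F} (hx : x ∈ modPow M n) (m : ℕ) :
    symProj R F m x = if n = m then x else 0 := by
  change (symDegree R F x).coeff m = _
  rw [symDegree_of_mem M hx, coeff_monomial]

end SymGrading

/-! ### The Rees algebra, the analytic spread and minimal reductions -/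

section Rees

variable {R F : Type*} [CommRing R] [AddCommGroup F] [Module R F] (M : Submodule R F)

lemma reesAlg_eq_adjoin :
    reesAlg M = Algebra.adjoin R (M.map (SymmetricAlgebra.ι R F) : Set (SymmetricAlgebra R F)) := by
  refine le_antisymm ?_ (Algebra.adjoin_le ?_)
  · rintro _ ⟨a, rfl⟩
    change (SymmetricAlgebra.lift _) a ∈ _
    induction a using SymmetricAlgebra.induction with
    | algebraMap r => rw [AlgHom.commutes]; exact Subalgebra.algebraMap_mem _ r
    | ι x =>
      rw [SymmetricAlgebra.lift_ι_apply]
      exact Algebra.subset_adjoin ⟨x, x.2, rfl⟩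
    | mul a b ha hb => rw [map_mul]; exact mul_mem ha hb
    | add a b ha hb => rw [map_add]; exact add_mem ha hb
  · rintro _ ⟨x, hx, rfl⟩
    refine ⟨SymmetricAlgebra.ι R M ⟨x, hx⟩, ?_⟩
    exact SymmetricAlgebra.lift_ι_apply (f := SymmetricAlgebra.ι R F ∘ₗ M.subtype) ⟨x, hx⟩

/-- The component of degree one of the Rees algebra. -/
def reesOne : Submodule R (reesAlg M) :=
  (M.map (SymmetricAlgebra.ι R F)).comap (reesAlg M).val.toLinearMap

lemma map_reesOne : (reesOne M).map (reesAlg M).val.toLinearMap =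
    M.map (SymmetricAlgebra.ι R F) := by
  rw [reesOne, Submodule.map_comap_eq_self]
  intro x hx
  have hx' : x ∈ reesAlg M := by
    rw [reesAlg_eq_adjoin]
    exact Algebra.subset_adjoin hx
  exact ⟨⟨x, hx'⟩, rfl⟩

lemma map_reesOne_pow (n : ℕ) :
    (reesOne M ^ n).map (reesAlg M).val.toLinearMap = modPow M n := by
  rw [Submodule.map_pow, map_reesOne, modPow]

lemma mem_reesOne_pow {n : ℕ} {a : reesAlg M} :
    a ∈ reesOne M ^ n ↔ (a : SymmetricAlgebra R F) ∈ modPow M n := by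
  rw [← map_reesOne_pow]
  refine ⟨fun h => ⟨a, h, rfl⟩, ?_⟩
  rintro ⟨b, hb, hba⟩
  rwa [← Subtype.val_injective hba]

lemma adjoin_reesOne : Algebra.adjoin R (reesOne M : Set (reesAlg M)) = ⊤ := by
  refine (Subalgebra.map_injective (f := (reesAlg M).val) Subtype.val_injective) ?_
  rw [AlgHom.map_adjoin, Algebra.map_top, Subalgebra.range_val]
  conv_rhs => rw [reesAlg_eq_adjoin, ← map_reesOne]
  rfl

variable {M} in
lemma fg_reesOne (hM : M.FG) : (reesOne M).FG := by
  refine Submodule.fg_of_fg_map_injective (reesAlg M).val.toLinearMap Subtype.val_injective ?_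
  rw [map_reesOne]
  exact hM.map _

lemma modPow_le_reesAlg {n : ℕ} {x : SymmetricAlgebra R F} (hx : x ∈ modPow M n) :
    x ∈ reesAlg M := by
  rw [← map_reesOne_pow] at hx
  obtain ⟨a, -, rfl⟩ := hx
  exact a.2

/-- The Rees algebra is spanned by the powers of its degree-one part, and the degree projections of
`Sym(F)` act on each power as identity or zero, hence preserve it. -/
lemma exists_reesProj : ∃ π : ℕ → reesAlg M →ₗ[R] reesAlg M,
    (∀ n, ∀ a ∈ reesOne M ^ n, π n a = a) ∧
      ∀ m n, m ≠ n → ∀ a ∈ reesOne M ^ m, π n a = 0 := by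
  have hmem : ∀ n (a : reesAlg M), symProj R F n a ∈ Subalgebra.toSubmodule (reesAlg M) := by
    intro n a
    have ha : a ∈ ⨆ n, reesOne M ^ n := top_eq_iSup_pow (adjoin_reesOne M) ▸ Submodule.mem_top
    induction ha using Submodule.iSup_induction' with
    | mem m a ha =>
      rw [symProj_of_mem M ((mem_reesOne_pow M).1 ha)]
      split_ifs
      exacts [a.2, zero_mem _]
    | zero => simp
    | add a b _ _ ha hb => rw [Subalgebra.coe_add, map_add]; exact add_mem ha hb
  refine ⟨fun n => (symProj R F n ∘ₗ (reesAlg M).val.toLinearMap).codRestrict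
    (Subalgebra.toSubmodule (reesAlg M)) (hmem n), fun n a ha => ?_, fun m n hmn a ha => ?_⟩
  · refine Subtype.ext ?_
    change symProj R F n a = a
    rw [symProj_of_mem M ((mem_reesOne_pow M).1 ha), if_pos rfl]
  · refine Subtype.ext ?_
    change symProj R F n a = 0
    rw [symProj_of_mem M ((mem_reesOne_pow M).1 ha), if_neg hmn]

lemma fg_modPow [IsNoetherianRing R] [Module.Finite R F] (n : ℕ) : (modPow M n).FG :=
  ((IsNoetherian.noetherian M).map _).pow n

variable [IsLocalRing R]

/-- The fiber cone of `M`. -/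
def FiberCone : Type _ :=
  reesAlg M ⧸ (IsLocalRing.maximalIdeal R).map (algebraMap R (reesAlg M))

instance : CommRing (FiberCone M) := inferInstanceAs (CommRing (_ ⧸ _))

instance : Algebra R (FiberCone M) := inferInstanceAs (Algebra R (_ ⧸ _))

/-- The quotient map from the Rees algebra to the fiber cone. -/
def toFiberCone : reesAlg M →ₐ[R] FiberCone M := Ideal.Quotient.mkₐ R _

lemma toFiberCone_surjective : Function.Surjective (toFiberCone M) := Ideal.Quotient.mk_surjective

lemma toFiberCone_eq_zero_iff {a : reesAlg M} : toFiberCone M a = 0 ↔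
    a ∈ IsLocalRing.maximalIdeal R • (⊤ : Submodule R (reesAlg M)) := by
  rw [Ideal.smul_top_eq_map]
  exact Ideal.Quotient.eq_zero_iff_mem

lemma algebraMap_fiberCone_eq_zero {a : R} (ha : a ∈ IsLocalRing.maximalIdeal R) :
    algebraMap R (FiberCone M) a = 0 :=
  Ideal.Quotient.eq_zero_iff_mem.2 (Ideal.mem_map_of_mem (algebraMap R (reesAlg M)) ha)

instance : Algebra (IsLocalRing.ResidueField R) (FiberCone M) :=
  RingHom.toAlgebra (R := IsLocalRing.ResidueField R) <|
    Ideal.Quotient.lift (IsLocalRing.maximalIdeal R) (algebraMap R (FiberCone M)) fun _ ha =>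
      algebraMap_fiberCone_eq_zero M ha

instance : IsScalarTower R (IsLocalRing.ResidueField R) (FiberCone M) :=
  .of_algebraMap_eq fun _ => rfl

variable [IsNoetherianRing R] [Module.Finite R F]

lemma relLength_modPow_ne_top {n e : ℕ} {Q : Submodule R (SymmetricAlgebra R F)}
    (hQ : IsLocalRing.maximalIdeal R ^ e • modPow M n ≤ Q) : relLength (modPow M n) Q ≠ ⊤ :=
  relLength_ne_top_of_pow_smul_le (fg_modPow M n) e hQ

lemma analyticSpread_le {C d : ℕ} (hC : ∀ n, ∑ m ∈ Finset.range (n + 1),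
      (relLength (modPow M m) (IsLocalRing.maximalIdeal R • modPow M m)).toNat ≤
        C * (n + 1) ^ d) : analyticSpread M ≤ d := by
  have hlen : ∀ n, relLength (reesOne M ^ n) (IsLocalRing.maximalIdeal R • reesOne M ^ n) =
      relLength (modPow M n) (IsLocalRing.maximalIdeal R • modPow M n) := fun n => by
    rw [← relLength_map_of_injective (f := (reesAlg M).val.toLinearMap) Subtype.val_injective,
      Submodule.map_smul'', map_reesOne_pow]
  have hfg : (reesOne M).FG := fg_reesOne (IsNoetherian.noetherian M)
  change ringKrullDim (FiberCone M) ≤ d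
  refine ringKrullDim_le_of_sum_relLength_le (W := reesOne M) (f := toFiberCone M) hfg
    (adjoin_reesOne M) (toFiberCone_surjective M)
    (Z := fun n => IsLocalRing.maximalIdeal R • reesOne M ^ n) (fun n z hz => ?_) (fun n => ?_)
    (C := C) fun n => ?_
  · exact (toFiberCone_eq_zero_iff M).2 (Submodule.smul_mono le_rfl le_top hz)
  · rw [hlen]
    exact relLength_modPow_ne_top M (e := 1) (by rw [pow_one])
  · simp only [hlen]
    exact hC n

/-- Existence of reductions of a power of `M` generated by `s` elements, the first `k` of which lie
in a prescribed family `Z` of small colength. -/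
theorem exists_reduction [Infinite (IsLocalRing.ResidueField R)] {s k : ℕ}
    (hs : analyticSpread M = (s : WithBot ℕ∞)) {Z : ℕ → Submodule R (SymmetricAlgebra R F)}
    (hle : ∀ n, Z n ≤ modPow M n) (hst : ∀ n, M.map (SymmetricAlgebra.ι R F) * Z n ≤ Z (n + 1))
    (hfin : ∀ n, relLength (modPow M n) (Z n) ≠ ⊤) {C : ℕ}
    (hC : ∀ n, ∑ m ∈ Finset.range (n + 1), (relLength (modPow M m) (Z m)).toNat ≤
      C * (n + 1) ^ (s - k)) :
    ∃ n, 1 ≤ n ∧ ∃ x : Fin s → SymmetricAlgebra R F,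
      IsReduction (Submodule.span R (Set.range x)) (modPow M n) ∧
        ∀ i : Fin s, (i : ℕ) < k → x i ∈ Z n := by
  let j := (reesAlg M).val.toLinearMap
  have hj : Function.Injective j := Subtype.val_injective
  have hZmap : ∀ n, ((Z n).comap j).map j = Z n := fun n =>
    Submodule.map_comap_eq_self fun z hz => ⟨⟨z, modPow_le_reesAlg M (hle n hz)⟩, rfl⟩
  have hlen : ∀ n, relLength (reesOne M ^ n) ((Z n).comap j) = relLength (modPow M n) (Z n) :=
    fun n => by rw [← relLength_map_of_injective hj, map_reesOne_pow, hZmap]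
  have hfg : (reesOne M).FG := fg_reesOne (IsNoetherian.noetherian M)
  have hdim : ringKrullDim (FiberCone M) ≤ s := hs.le
  obtain ⟨d, hd, x, hx, hxZ, hxfin⟩ := exists_parameters_of_sum_relLength_le
    (W := reesOne M) (f := toFiberCone M) hfg (adjoin_reesOne M) (toFiberCone_surjective M)
    hdim (Z := fun n => (Z n).comap j)
    (fun n a ha => (mem_reesOne_pow M).2 (hle n ha))
    (fun n => Submodule.mul_le.2 fun a ha b hb => hst n (Submodule.mul_mem_mul ha hb))
    (fun n => by rw [hlen]; exact hfin n) (C := C) (fun n => by simp only [hlen]; exact hC n)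
  obtain ⟨π, hπ, hπ'⟩ := exists_reesProj M
  obtain ⟨c, hc⟩ := exists_pow_le_of_finite (adjoin_reesOne M) hπ hπ' (toFiberCone_surjective M)
    (fun a => (toFiberCone_eq_zero_iff M).1) hx hxfin
  have hspan : Submodule.span R (Set.range fun i => (x i : SymmetricAlgebra R F)) =
      (Submodule.span R (Set.range x)).map j := by
    rw [Submodule.map_span, ← Set.range_comp]
    rfl
  refine ⟨d, hd, fun i => x i, isReduction_pow_of_le (c := c) hd ?_ fun n hn => ?_, hxZ⟩
  · rw [Submodule.span_le]
    rintro _ ⟨i, rfl⟩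
    exact (mem_reesOne_pow M).1 (hx i)
  -- Nakayama removes the term `𝔪 M^(n+d)` left over from lifting out of the fiber cone.
  · refine Submodule.le_of_le_smul_of_le_jacobson_bot (I := IsLocalRing.maximalIdeal R)
      (fg_modPow M (n + d)) (IsLocalRing.maximalIdeal_le_jacobson _) ?_
    have h := Submodule.map_mono (f := j) (hc n hn)
    rw [Submodule.map_sup, Submodule.map_smul'', map_reesOne_pow, Submodule.map_mul,
      map_reesOne_pow, ← hspan] at h
    exact h

/-- A reduction of a power of `M` generated by as many elements as the analytic spread is
minimal. -/
theorem IsReduction.isMinimalReduction {s d : ℕ} (hd : 1 ≤ d)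
    (hs : analyticSpread M = (s : WithBot ℕ∞)) {x : Fin s → SymmetricAlgebra R F}
    (hx : IsReduction (Submodule.span R (Set.range x)) (modPow M d)) :
    IsMinimalReduction (Submodule.span R (Set.range x)) (modPow M d) := by
  refine ⟨hx, fun N hN hNx => ?_⟩
  by_contra hne
  set 𝔪 := IsLocalRing.maximalIdeal R
  have hne' : ¬ Submodule.span R (Set.range x) ≤ N ⊔ 𝔪 • Submodule.span R (Set.range x) :=
    fun h => hne (Submodule.le_of_le_smul_of_le_jacobson_bot
      (Submodule.fg_span (Set.finite_range x)) (IsLocalRing.maximalIdeal_le_jacobson _) h)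
  -- A strictly smaller reduction would be generated modulo `𝔪` by `t < s` elements. These
  -- eventually generate the fiber cone in steps of degree `d`, so its growth gives analytic spread
  -- at most `t`.
  obtain ⟨t, hts, y, hyN, hy⟩ := exists_lt_span x hNx hne'
  obtain ⟨c, hc⟩ := hN.exists_pow_le
  have hyM : ∀ i, y i ∈ modPow M d := fun i => hN.1 (hyN i)
  have hmul : ∀ i n, (modPow M n).map (LinearMap.mulLeft R (y i)) ≤ modPow M (n + d) := by
    rintro i n _ ⟨a, ha, rfl⟩
    rw [modPow, add_comm, pow_add]
    exact Submodule.mul_mem_mul (hyM i) ha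
  obtain ⟨C, hC⟩ := exists_sum_relLength_le (Finset.univ : Finset (Fin t)) y hd
    (P := modPow M) (Q := fun n => 𝔪 • modPow M n) (fun n => Submodule.smul_le_right)
    (fun i _ n => hmul i n)
    (fun i _ n => by rw [Submodule.map_smul'']; exact Submodule.smul_mono le_rfl (hmul i n))
    (fun n => relLength_modPow_ne_top M (e := 1) (by rw [pow_one]))
    ⟨c, fun n hn => by
      refine (hc n hn).trans ((mul_le_mul_left hy _).trans ?_)
      rw [Submodule.sup_mul, sup_comm]
      refine sup_le_sup ?_ ?_
      · rw [smul_mul_assoc]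
        refine Submodule.smul_mono le_rfl ?_
        rw [modPow, add_comm, pow_add]
        exact mul_le_mul_left hx.1 _
      · refine Submodule.mul_le.2 fun a ha b hb => ?_
        induction ha using Submodule.span_induction with
        | mem a ha =>
          obtain ⟨i, rfl⟩ := ha
          exact Submodule.mem_iSup_of_mem i
            (Submodule.mem_iSup_of_mem (Finset.mem_univ i) ⟨b, hb, rfl⟩)
        | zero => simp
        | add a a' _ _ ha ha' => rw [add_mul]; exact add_mem ha ha'
        | smul r a _ ha => rw [smul_mul_assoc]; exact Submodule.smul_mem _ r ha⟩
  rw [Finset.card_univ, Fintype.card_fin] at hC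
  have h := analyticSpread_le M hC
  rw [hs] at h
  exact absurd (by exact_mod_cast h) (not_le.2 hts)

end Rees

/-! ### Products with ideal multiples and the graded pieces `L M^n / I(M) M^(n+1)` -/

section IdealSMul

variable {R S : Type*} [CommRing R] [CommRing S] [Algebra R S]

lemma ideal_smul_mul (I : Ideal R) (X Y : Submodule R S) : (I • X) * Y = I • (X * Y) := by
  rw [smul_mul_assoc]

lemma mul_ideal_smul (I : Ideal R) (X Y : Submodule R S) : X * (I • Y) = I • (X * Y) := by
  rw [mul_comm, ideal_smul_mul, mul_comm]

end IdealSMul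

section GradedLength

variable {R F : Type*} [CommRing R] [AddCommGroup F] [Module R F]

lemma gradedLength_succ (M L : Submodule R F) (n : ℕ) : gradedLength M L (n + 1) =
    relLength (L.map (SymmetricAlgebra.ι R F) * modPow M n) (fittM M • modPow M (n + 1)) := rfl

lemma map_mul_modPow_le {M L : Submodule R F} (hL : L ≤ M) (n : ℕ) :
    L.map (SymmetricAlgebra.ι R F) * modPow M n ≤ modPow M (n + 1) := by
  rw [modPow, modPow, pow_succ']
  exact mul_le_mul_left (Submodule.map_mono hL) _

lemma smul_modPow_le {M L : Submodule R F} (hL : fittM M • M ≤ L) (n : ℕ) :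
    fittM M • modPow M (n + 1) ≤ L.map (SymmetricAlgebra.ι R F) * modPow M n := by
  have h := mul_le_mul_left (Submodule.map_mono (f := SymmetricAlgebra.ι R F) hL) (modPow M n)
  rwa [Submodule.map_smul'', ideal_smul_mul, modPow, ← pow_succ'] at h

end GradedLength

/-! ### Coefficient modules -/

section CoefficientModules

open IsLocalRing

variable {R F : Type*} [CommRing R] [IsLocalRing R] [IsNoetherianRing R] [AddCommGroup F]
  [Module R F] [Module.Finite R F]

/-- Some `𝔪^n` kills `F / M`, by stabilization and Nakayama. For `a` in it, the scalar matrix `a` is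
a relation matrix on `r` generators, so `a^r` lies in the Fitting ideal; finite generation turns
this into a containment of a power of `𝔪`. -/
lemma exists_maximalIdeal_pow_le_fittM {M : Submodule R F} (hM : IsFiniteLength R (F ⧸ M)) :
    ∃ e, maximalIdeal R ^ e ≤ fittM M := by
  obtain ⟨-, hart⟩ := isFiniteLength_iff_isNoetherian_isArtinian.1 hM
  obtain ⟨n, hn⟩ := IsArtinian.monotone_stabilizes (R := R) (M := F ⧸ M)
    { toFun := fun n => OrderDual.toDual (maximalIdeal R ^ n • (⊤ : Submodule R (F ⧸ M)))
      monotone' := fun m n h => Submodule.smul_mono (Ideal.pow_le_pow_right h) le_rfl }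
  have h1 : maximalIdeal R ^ n • (⊤ : Submodule R (F ⧸ M)) = maximalIdeal R ^ (n + 1) • ⊤ :=
    hn (n + 1) n.le_succ
  have h2 : maximalIdeal R ^ n • (⊤ : Submodule R (F ⧸ M)) = ⊥ := by
    refine Submodule.eq_bot_of_le_smul_of_le_jacobson_bot (maximalIdeal R) _
      (IsNoetherian.noetherian _) ?_ (maximalIdeal_le_jacobson _)
    rw [← mul_smul, ← pow_succ']
    exact h1.le
  obtain ⟨r, g, hg⟩ := Module.Finite.exists_fin (R := R) (M := F ⧸ M)
  have h3 : maximalIdeal R ^ n ≤ (fittM M).radical := fun a ha => by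
    refine ⟨r, Ideal.subset_span ⟨r, g, Matrix.diagonal fun _ => a, hg, fun i => ?_, by simp⟩⟩
    simp only [Matrix.diagonal_apply, ite_smul, zero_smul, Finset.sum_ite_eq, Finset.mem_univ,
      if_true]
    have h4 : a • g i ∈ maximalIdeal R ^ n • (⊤ : Submodule R (F ⧸ M)) :=
      Submodule.smul_mem_smul ha Submodule.mem_top
    rwa [h2, Submodule.mem_bot] at h4
  obtain ⟨m, hm⟩ := Ideal.exists_pow_le_of_le_radical_of_fg h3 (IsNoetherian.noetherian _)
  exact ⟨n * m, by rwa [pow_mul]⟩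

lemma gradedLength_succ_ne_top {M L : Submodule R F} {e : ℕ} (he : maximalIdeal R ^ e ≤ fittM M)
    (hL : L ≤ M) (n : ℕ) : gradedLength M L (n + 1) ≠ ⊤ :=
  relLength_ne_top_of_le (map_mul_modPow_le hL n) le_rfl
    (relLength_modPow_ne_top M (Submodule.smul_mono he le_rfl))

/-- Membership in `coeffSet M s k` as a growth condition. -/
theorem mem_coeffSet_iff {M L : Submodule R F} {e : ℕ} (he : maximalIdeal R ^ e ≤ fittM M)
    (hL : fittM M • M ≤ L) (hL' : L ≤ M) {s k : ℕ} :
    L ∈ coeffSet M s k ↔ ∃ C : ℕ, ∀ n, ∑ m ∈ Finset.range (n + 1),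
      (gradedLength M L (m + 1)).toNat ≤ C * (n + 1) ^ (s - k) := by
  constructor
  · rintro ⟨-, -, p, hp, hev⟩
    obtain ⟨C, hC⟩ := exists_sum_le_of_degree_lt (h := fun n => (gradedLength M L n).toNat)
      (hev.mono fun n ⟨l, hl, hlp⟩ => by rw [hl, ENat.toNat_natCast, hlp]) hp
    refine ⟨C * 2 ^ (s - k), fun n => ?_⟩
    calc _ ≤ ∑ m ∈ Finset.range (n + 1 + 1), (gradedLength M L m).toNat := by
          rw [Finset.sum_range_succ' _ (n + 1)]
          exact Nat.le_add_right _ _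
      _ ≤ C * (n + 1 + 1) ^ (s - k) := hC (n + 1)
      _ ≤ C * (2 * (n + 1)) ^ (s - k) := by gcongr; omega
      _ = _ := by rw [mul_pow, mul_assoc]
  · rintro ⟨C, hC⟩
    set V := M.map (SymmetricAlgebra.ι R F)
    -- Degree `n` of the module is `L M^(n-1)`; degree zero is set to `⊥` so that `P n ≤ V^n`
    -- without a shift.
    let P : ℕ → Submodule R (SymmetricAlgebra R F) := fun n =>
      n.casesOn ⊥ fun m => L.map (SymmetricAlgebra.ι R F) * modPow M m
    let Q : ℕ → Submodule R (SymmetricAlgebra R F) := fun n =>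
      n.casesOn ⊥ fun m => fittM M • modPow M (m + 1)
    obtain ⟨p, n₀, hp⟩ := exists_hilbert_polynomial (V := V)
      ((IsNoetherian.noetherian M).map _) (P := P) (Q := Q)
      (by rintro (_ | n); exacts [le_rfl, smul_modPow_le hL n])
      (by rintro (_ | n); exacts [bot_le, map_mul_modPow_le hL' n])
      (by
        rintro (_ | n)
        · change V * ⊥ ≤ _
          rw [Submodule.mul_bot]
          exact bot_le
        · change V * (L.map (SymmetricAlgebra.ι R F) * V ^ n) ≤
            L.map (SymmetricAlgebra.ι R F) * V ^ (n + 1)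
          rw [mul_left_comm, pow_succ'])
      (by
        rintro (_ | n)
        · change V * ⊥ ≤ _
          rw [Submodule.mul_bot]
          exact bot_le
        · change V * (fittM M • V ^ (n + 1)) ≤ fittM M • V ^ (n + 1 + 1)
          rw [mul_ideal_smul, pow_succ' V (n + 1)])
      (by
        rintro (_ | n)
        · exact (relLength_eq_zero_iff.2 le_rfl).trans_ne ENat.zero_ne_top
        · exact gradedLength_succ_ne_top he hL' n)
    refine ⟨hL, hL', p, degree_lt_of_sum_le (h := fun n => (relLength (P n) (Q n)).toNat) (C := C)
      (Filter.eventually_atTop.2 ⟨n₀, hp⟩) (fun n => ?_),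
      Filter.eventually_atTop.2 ⟨n₀ + 1, fun n hn => ?_⟩⟩
    · have h0 : (relLength (P 0) (Q 0)).toNat = 0 :=
        congrArg ENat.toNat (relLength_eq_zero_iff.2 le_rfl)
      rw [Finset.sum_range_succ', h0, add_zero]
      cases n with
      | zero => simp
      | succ n => exact (hC n).trans (by gcongr; omega)
    · obtain ⟨m, rfl⟩ := Nat.exists_eq_add_of_le' (show 1 ≤ n by omega)
      refine ⟨_, (ENat.natCast_toNat (gradedLength_succ_ne_top he hL' m)).symm, ?_⟩
      exact hp (m + 1) (by omega)

lemma smul_mem_coeffSet {M : Submodule R F} {e : ℕ} (he : maximalIdeal R ^ e ≤ fittM M)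
    (s k : ℕ) : fittM M • M ∈ coeffSet M s k := by
  rw [mem_coeffSet_iff he le_rfl Submodule.smul_le_right]
  refine ⟨0, fun n => ?_⟩
  rw [Finset.sum_eq_zero fun m _ => ?_, zero_mul]
  rw [gradedLength_succ, relLength_eq_zero_iff.2]
  · rfl
  · rw [Submodule.map_smul'', ideal_smul_mul, modPow, modPow, pow_succ']

lemma sup_mem_coeffSet {M L L' : Submodule R F} {e : ℕ} (he : maximalIdeal R ^ e ≤ fittM M)
    {s k : ℕ} (h : L ∈ coeffSet M s k) (h' : L' ∈ coeffSet M s k) : L ⊔ L' ∈ coeffSet M s k := by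
  have hL := h.2.1
  have hL' := h'.2.1
  obtain ⟨C, hC⟩ := (mem_coeffSet_iff he h.1 hL).1 h
  obtain ⟨C', hC'⟩ := (mem_coeffSet_iff he h'.1 hL').1 h'
  refine (mem_coeffSet_iff he (h.1.trans le_sup_left) (sup_le hL hL')).2
    ⟨C + C', fun n => ?_⟩
  rw [add_mul]
  refine le_trans ?_ (add_le_add (hC n) (hC' n))
  rw [← Finset.sum_add_distrib]
  refine Finset.sum_le_sum fun m _ => ?_
  have h1 := gradedLength_succ_ne_top he hL m
  have h2 := gradedLength_succ_ne_top he hL' m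
  rw [← ENat.toNat_add h1 h2]
  refine ENat.toNat_le_toNat ?_ (by simp [h1, h2])
  rw [gradedLength_succ, Submodule.map_sup, Submodule.sup_mul]
  exact relLength_sup_le _ _ _

lemma isGreatest_coeffModule {M : Submodule R F} {e : ℕ} (he : maximalIdeal R ^ e ≤ fittM M)
    (s k : ℕ) : IsGreatest (coeffSet M s k) (coeffModule M s k) := by
  obtain ⟨G, hG, hmax⟩ := set_has_maximal_iff_noetherian.2
    (inferInstance : IsNoetherian R F) (coeffSet M s k) ⟨_, smul_mem_coeffSet he s k⟩
  have hgr : IsGreatest (coeffSet M s k) G := ⟨hG, fun L hL => by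
    by_contra hne
    exact hmax _ (sup_mem_coeffSet he hG hL) (left_lt_sup.2 hne)⟩
  rwa [coeffModule, hgr.isLUB.sSup_eq]

/-- The first `k` of the `x i` annihilate `⊕ L M^n / I(M) M^(n+1)`, so only the other `s - k`
contribute to its growth. -/
lemma sup_span_mem_coeffSet {M : Submodule R F} {e : ℕ} (he : maximalIdeal R ^ e ≤ fittM M)
    {s k d : ℕ} (hd : 1 ≤ d) {x : Fin s → SymmetricAlgebra R F}
    (hx : IsReduction (Submodule.span R (Set.range x)) (modPow M d)) {y : F} (hyM : y ∈ M)
    (hy : y ∈ colonF (fittM M • modPow M (d + 1)) x k) :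
    Submodule.span R {y} ⊔ fittM M • M ∈ coeffSet M s k := by
  set L := Submodule.span R {y} ⊔ fittM M • M
  set V := M.map (SymmetricAlgebra.ι R F)
  set W := L.map (SymmetricAlgebra.ι R F)
  have hIL : fittM M • M ≤ L := le_sup_right
  have hLM : L ≤ M := sup_le ((Submodule.span_singleton_le_iff_mem _ _).2 hyM)
    Submodule.smul_le_right
  refine (mem_coeffSet_iff he hIL hLM).2 ?_
  have hxV : ∀ i, x i ∈ V ^ d := fun i => hx.1 (Submodule.subset_span ⟨i, rfl⟩)
  -- For the summand `I(M) M` this is automatic from `x i ∈ V^d`; only `y` uses the colon condition.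
  have hkill : ∀ i : Fin s, (i : ℕ) < k → ∀ w ∈ W, w * x i ∈ fittM M • V ^ (d + 1) := by
    intro i hi
    suffices h : W ≤ (fittM M • V ^ (d + 1)).comap (LinearMap.mulRight R (x i)) from h
    rw [Submodule.map_le_iff_le_comap]
    refine sup_le ((Submodule.span_singleton_le_iff_mem _ _).2 (hy i hi)) ?_
    rw [← Submodule.map_le_iff_le_comap, Submodule.map_smul'']
    intro w hw
    have h1 := Submodule.mul_mem_mul hw (hxV i)
    rwa [ideal_smul_mul, ← pow_succ'] at h1
  obtain ⟨c, hc⟩ := hx.exists_pow_le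
  let J : Finset (Fin s) := Finset.univ.filter fun i => k ≤ (i : ℕ)
  have hJ : J.card ≤ s - k := by
    rw [← Nat.card_Ico]
    refine Finset.card_le_card_of_injOn Fin.val (fun i hi => ?_) Fin.val_injective.injOn
    have := (Finset.mem_filter.1 hi).2
    simpa using this
  obtain ⟨C, hC⟩ := exists_sum_relLength_le J x hd (P := fun n => W * modPow M n)
    (Q := fun n => fittM M • modPow M (n + 1)) (fun n => smul_modPow_le hIL n)
    (fun i _ n => by
      rintro _ ⟨a, ha, rfl⟩
      have h1 := Submodule.mul_mem_mul ha (hxV i)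
      rw [mul_assoc, modPow, ← pow_add] at h1
      rw [LinearMap.mulLeft_apply, mul_comm (x i) a]
      exact h1)
    (fun i _ n => by
      rintro _ ⟨a, ha, rfl⟩
      have h1 := Submodule.mul_mem_mul ha (hxV i)
      rw [ideal_smul_mul, modPow, ← pow_add, mul_comm, add_right_comm] at h1
      exact h1)
    (fun n => gradedLength_succ_ne_top he hLM n)
    ⟨c, fun n hn => by
      refine (mul_le_mul_right (hc n hn) W).trans ?_
      rw [← mul_assoc]
      refine Submodule.mul_le.2 fun a ha b hb => ?_
      induction ha using Submodule.mul_induction_on' with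
      | add a _ a' _ h h' => rw [add_mul]; exact add_mem h h'
      | mem_mul_mem w hw a ha =>
        induction ha using Submodule.span_induction with
        | zero => simp
        | add a a' _ _ h h' => rw [mul_add, add_mul]; exact add_mem h h'
        | smul r a _ h => rw [mul_smul_comm, smul_mul_assoc]; exact Submodule.smul_mem _ r h
        | mem a ha =>
          obtain ⟨i, rfl⟩ := ha
          by_cases hi : k ≤ (i : ℕ)
          · refine Submodule.mem_sup_right (Submodule.mem_iSup_of_mem i
              (Submodule.mem_iSup_of_mem (by simpa [J] using hi) ⟨w * b, ?_, ?_⟩))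
            · exact Submodule.mul_mem_mul hw hb
            · rw [LinearMap.mulLeft_apply]
              ring
          · refine Submodule.mem_sup_left ?_
            have h1 := Submodule.mul_mem_mul (hkill i (not_le.1 hi) w hw) hb
            rwa [ideal_smul_mul, ← pow_add, show d + 1 + n = n + d + 1 by ring] at h1⟩
  exact ⟨C, fun n => (hC n).trans (Nat.mul_le_mul_left _ (Nat.pow_le_pow_right n.succ_pos hJ))⟩

/-- The elements of `coeffSet M s k` are annihilated, modulo `I(M)`, by the first `k` members of a
minimal reduction of some power of `M`. -/
lemma exists_isMinimalReduction_of_mem_coeffSet [Infinite (ResidueField R)]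
    {M L : Submodule R F} {e : ℕ} (he : maximalIdeal R ^ e ≤ fittM M) {s k : ℕ}
    (hs : analyticSpread M = (s : WithBot ℕ∞)) (hL : L ∈ coeffSet M s k) :
    ∃ n₀, 1 ≤ n₀ ∧ ∃ x : Fin s → SymmetricAlgebra R F,
      IsMinimalReduction (Submodule.span R (Set.range x)) (modPow M n₀) ∧
        L ≤ colonF (fittM M • modPow M (n₀ + 1)) x k := by
  obtain ⟨C, hC⟩ := (mem_coeffSet_iff he hL.1 hL.2.1).1 hL
  set V := M.map (SymmetricAlgebra.ι R F)
  obtain ⟨t, ht⟩ := IsNoetherian.noetherian L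
  have htL : ∀ w ∈ t, SymmetricAlgebra.ι R F w ∈ L.map (SymmetricAlgebra.ι R F) := fun w hw =>
    Submodule.mem_map_of_mem (ht ▸ Submodule.subset_span hw)
  let Y : ℕ → F → Submodule R (SymmetricAlgebra R F) := fun n w =>
    (fittM M • modPow M (n + 1)).comap (LinearMap.mulLeft R (SymmetricAlgebra.ι R F w))
  -- `Z` is the annihilator of `⊕ L M^n / I(M) M^(n+1)` tested on generators of `L`. Multiplication
  -- by `w` embeds `M^n / (M^n ⊓ Y n w)` into `L M^n / I(M) M^(n+1)`, which gives the colength bound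
  -- below.
  let Z : ℕ → Submodule R (SymmetricAlgebra R F) := fun n => modPow M n ⊓ ⨅ w ∈ t, Y n w
  have hZmem : ∀ {n z}, z ∈ Z n → ∀ w ∈ t,
      SymmetricAlgebra.ι R F w * z ∈ fittM M • modPow M (n + 1) := fun hz w hw => by
    have h1 := (Submodule.mem_iInf _).1 hz.2 w
    exact (Submodule.mem_iInf _).1 h1 hw
  have hlen : ∀ n, relLength (modPow M n) (Z n) ≤ t.card • gradedLength M L (n + 1) := by
    intro n
    refine (relLength_congr_right (Q' := ⨅ w ∈ t, Y n w) (by simp [Z])).trans_le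
      ((relLength_iInf_le t _ _).trans (Finset.sum_le_card_nsmul _ _ _ fun w hw => ?_))
    rw [← relLength_map_sup]
    refine relLength_mono_left (sup_le ?_ (smul_modPow_le hL.1 n)) _
    rintro _ ⟨a, ha, rfl⟩
    exact Submodule.mul_mem_mul (htL w hw) ha
  have hne : ∀ n, t.card • gradedLength M L (n + 1) ≠ ⊤ := fun n => by
    rw [nsmul_eq_mul]
    exact WithTop.mul_ne_top (ENat.natCast_ne_top _) (gradedLength_succ_ne_top he hL.2.1 n)
  obtain ⟨n₀, hn₀, x, hx, hxZ⟩ := exists_reduction (k := k) M hs (Z := Z) (fun n => inf_le_left)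
    (fun n => Submodule.mul_le.2 fun v hv z hz => by
      refine ⟨?_, ?_⟩
      · have h1 := Submodule.mul_mem_mul hv hz.1
        rwa [modPow, ← pow_succ'] at h1
      · refine (Submodule.mem_iInf _).2 fun w => (Submodule.mem_iInf _).2 fun hw => ?_
        have h1 := Submodule.mul_mem_mul hv (hZmem hz w hw)
        rw [mul_ideal_smul, modPow, ← pow_succ', mul_left_comm] at h1
        exact h1)
    (fun n => ne_top_of_le_ne_top (hne n) (hlen n)) (C := t.card * C) (fun n => by
      refine (Finset.sum_le_sum fun m _ => ENat.toNat_le_toNat (hlen m) (hne m)).trans ?_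
      simp only [nsmul_eq_mul, ENat.toNat_mul, ENat.toNat_natCast, ← Finset.mul_sum]
      rw [mul_assoc]
      exact Nat.mul_le_mul_left _ (hC n))
  refine ⟨n₀, hn₀, x, hx.isMinimalReduction M hn₀ hs, ?_⟩
  rw [← ht, Submodule.span_le]
  exact fun w hw i hi => hZmem (hxZ i hi) w hw

end CoefficientModules

end CoeffModules

end

theorem theorem4p4 {R : Type*} [CommRing R] [IsLocalRing R] [IsNoetherianRing R]
    [Infinite (IsLocalRing.ResidueField R)]
    {F : Type*} [AddCommGroup F] [Module R F] [Module.Free R F] [Module.Finite R F]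
    (M : Submodule R F) (hM : IsFiniteLength R (F ⧸ M))
    (s : ℕ) (hs : 1 ≤ s) (hspread : CoeffModules.analyticSpread M = (s : WithBot ℕ∞))
    (k : ℕ) (hk : 1 ≤ k) (hks : k ≤ s) :
    IsGreatest (CoeffModules.coeffSet M s k) (CoeffModules.coeffModule M s k) ∧
    (CoeffModules.coeffModule M s k : Set F) =
      {y : F | ∃ n₀ : ℕ, 1 ≤ n₀ ∧ ∃ x : Fin s → SymmetricAlgebra R F,
        CoeffModules.IsMinimalReduction (Submodule.span R (Set.range x))
          (CoeffModules.modPow M n₀) ∧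
        y ∈ M ⊓ CoeffModules.colonF
          (CoeffModules.fittM M • CoeffModules.modPow M (n₀ + 1)) x k} := by
  obtain ⟨e, he⟩ := CoeffModules.exists_maximalIdeal_pow_le_fittM hM
  have hgr := CoeffModules.isGreatest_coeffModule he s k
  refine ⟨hgr, Set.ext fun y => ⟨fun hy => ?_, ?_⟩⟩
  -- Applied to the greatest element itself, this produces one tuple valid for all of it, so the
  -- union is attained by a single colon.
  · obtain ⟨n₀, hn₀, x, hmin, hle⟩ :=
      CoeffModules.exists_isMinimalReduction_of_mem_coeffSet he hspread hgr.1
    exact ⟨n₀, hn₀, x, hmin, hgr.1.2.1 hy, hle hy⟩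
  · rintro ⟨n₀, hn₀, x, hmin, hyM, hyc⟩
    exact hgr.2 (CoeffModules.sup_span_mem_coeffSet he hn₀ hmin.1 hyM hyc)
      (Submodule.mem_sup_left (Submodule.mem_span_singleton_self y))
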